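/- **Theorem (Łoś's theorem for ultrafibers).** Let $M$ be a finite von Neumann algebra on a Hilbert space $H$, let $N\subseteq Z(M)$ be a von Neumann subalgebra of its center, let $E:M\to N$ be a normal, faithful, tracial conditional expectation, and let $\mathcal U$ be a character on $N$ (a nonzero multiplicative linear functional $N\to\mathbb C$). Let $I_{E,\mathcal U}=\{x\in M:\mathcal U(E(x^*x))=0\}$, a closed two-sided ideal, let $M^{/E,\mathcal U}=M/I_{E,\mathcal U}$ be the ultrafiber (with the quotient norm), equipped with the trace $\tau_{E,\mathcal U}(x+I_{E,\mathcal U})=\mathcal U(E(x))$, and let $\pi:M\to M^{/E,\mathcal U}$ be the quotient map. Formulas with variables from a set $X$ are the formal expressions generated by: (1) $\operatorname{Re}\operatorname{tr}(p)$ and $\operatorname{Im}\operatorname{tr}(p)$ for non-commutative $*$-polynomials $p$ with complex coefficients in the variables; (2) $f(\varphi_1,\dots,\varphi_k)$ for formulas $\varphi_i$ and continuous $f:\mathbb R^k\to\mathbb R$; (3) $\sup_y\varphi$ and $\inf_y\varphi$ for a formula $\varphi$ and a variable $y$. The interpretation $\varphi^{M^{/E,\mathcal U}}$ takes real values: $\operatorname{Re}\operatorname{tr}(p)$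 and $\operatorname{Im}\operatorname{tr}(p)$ are evaluated as the real and imaginary part of $\tau_{E,\mathcal U}(p(\cdot))$, connectives are applied to real numbers, and $\sup_y$, $\inf_y$ are the supremum and infimum over $y$ in the closed unit ball of $M^{/E,\mathcal U}$. The $N$-valued interpretation $\varphi^M_E$ takes values in the self-adjoint part $N_{\mathrm{sa}}$: $\operatorname{Re}\operatorname{tr}(p)$ and $\operatorname{Im}\operatorname{tr}(p)$ are evaluated as the real and imaginary part of $E(p(\cdot))$, connectives are applied by the continuous functional calculus of the commutative $\mathrm C^*$-algebra $N$, and $\sup_y$, $\inf_y$ are the supremum and infimum in the ordered set $N_{\mathrm{sa}}$ over $y$ in the closed unit ball of $M$. Then for every formula $\varphi$ and every assignment $\overline x$ of elements of $M$ to the variables (in particular, for every tuple in the unit ball of $M$), $$\varphi^{M^{/E,\mathcal U}}(\pi(\overline x))=\mathcal U\big(\varphi^M_E(\overline x)\big).$$ -/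

import Mathlib

open scoped ComplexStarModule

noncomputable section

universe u v

/-! ### Von Neumann algebras as C*-algebras, finiteness, central subalgebras -/

namespace VonNeumannAlgebra

variable {H : Type u} [NormedAddCommGroup H] [InnerProductSpace ℂ H] [CompleteSpace H]

instance instSMulMemClassComplex : SMulMemClass (VonNeumannAlgebra H) ℂ (H →L[ℂ] H) where
  smul_mem {S} c _ hx := S.toStarSubalgebra.smul_mem hx c

instance instIsClosedCoe (M : VonNeumannAlgebra H) : IsClosed (M : Set (H →L[ℂ] H)) := by
  rw [← M.centralizer_centralizer]
  exact Set.isClosed_centralizer _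

/-- A von Neumann algebra is finite if every isometry in it is unitary. -/
def IsFinite (M : VonNeumannAlgebra H) : Prop :=
  ∀ w ∈ M, star w * w = 1 → w * star w = 1

/-- `N` is contained in the center `M ∩ M'` of `M`. -/
structure IsCentralIn (N M : VonNeumannAlgebra H) : Prop where
  le : N ≤ M
  le_commutant : N ≤ M.commutant

namespace IsCentralIn

variable {N M : VonNeumannAlgebra H}

/-- The inclusion of a central von Neumann subalgebra. -/
def incl (hN : N.IsCentralIn M) (a : N) : M := ⟨a, hN.le a.2⟩

theorem incl_mul_comm (hN : N.IsCentralIn M) (a : N) (x : M) :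
    hN.incl a * x = x * hN.incl a :=
  Subtype.ext (VonNeumannAlgebra.mem_commutant_iff.1 (hN.le_commutant a.2) x x.2).symm

/-- A central von Neumann subalgebra is a commutative C*-algebra. -/
abbrev commCStarAlgebra (hN : N.IsCentralIn M) : CommCStarAlgebra N where
  __ := (inferInstance : CStarAlgebra N)
  mul_comm a b := Subtype.ext
    (VonNeumannAlgebra.mem_commutant_iff.1 (hN.le_commutant a.2) b (hN.le b.2)).symm

/-- Continuous functional calculus in several variables on the commutative C*-algebra `N`:
the Gelfand transform of `f (a₁, …, aₖ)` is the function `χ ↦ f (χ a₁, …, χ aₖ)`. -/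
def functionalCalculus (hN : N.IsCentralIn M) {k : ℕ} (f : C(Fin k → ℝ, ℝ))
    (a : Fin k → selfAdjoint N) : selfAdjoint N :=
  letI := hN.commCStarAlgebra
  ⟨(gelfandStarTransform N).symm
      ⟨fun χ => ((f fun i => (χ (a i : N)).re : ℝ) : ℂ), by
        refine Complex.continuous_ofReal.comp (f.continuous.comp (continuous_pi fun i => ?_))
        exact Complex.continuous_re.comp (gelfandStarTransform N (a i : N)).continuous⟩, by
    rw [selfAdjoint.mem_iff, ← map_star]
    congr 1
    ext χ
    simp⟩

end IsCentralIn

end VonNeumannAlgebra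

/-- A normal, faithful, tracial conditional expectation from a von Neumann algebra `M` onto a
von Neumann subalgebra `N` of its center. The order on `M` and `N` is the usual order of
operators. -/
structure TracialExpectation {H : Type u} [NormedAddCommGroup H] [InnerProductSpace ℂ H]
    [CompleteSpace H] {N M : VonNeumannAlgebra H} (hN : N.IsCentralIn M) where
  toLinearMap : M →ₗ[ℂ] N
  map_incl : ∀ a : N, toLinearMap (hN.incl a) = a
  map_bimodule : ∀ (a b : N) (x : M),
    toLinearMap (hN.incl a * x * hN.incl b) = a * toLinearMap x * b
  map_nonneg : ∀ x : M, 0 ≤ x → 0 ≤ toLinearMap x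
  tracial : ∀ x y : M, toLinearMap (x * y) = toLinearMap (y * x)
  faithful : ∀ x : M, toLinearMap (star x * x) = 0 → x = 0
  /-- normality: suprema of increasing nets of self-adjoint elements are preserved -/
  normal : ∀ (D : Set M) (x : M), D.Nonempty → (∀ d ∈ D, IsSelfAdjoint d) →
    DirectedOn (· ≤ ·) D → IsLUB D x → IsLUB (toLinearMap '' D) (toLinearMap x)

/-! ### Ultrafibers -/

namespace TracialExpectation

open scoped ComplexOrder

variable {H : Type u} [NormedAddCommGroup H] [InnerProductSpace ℂ H] [CompleteSpace H]
  {N M : VonNeumannAlgebra H} {hN : N.IsCentralIn M}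

/-- The functional `U ∘ E` on `M`. -/
def state (E : TracialExpectation hN) (U : WeakDual.characterSpace ℂ N) : M →ₗ[ℂ] ℂ :=
  (WeakDual.CharacterSpace.toAlgHom U).toLinearMap ∘ₗ E.toLinearMap

theorem state_apply (E : TracialExpectation hN) (U : WeakDual.characterSpace ℂ N) (x : M) :
    E.state U x = U (E.toLinearMap x) := rfl

theorem character_nonneg (U : WeakDual.characterSpace ℂ N) {a : N} (ha : 0 ≤ a) :
    0 ≤ U a := by
  have ha' : (0 : H →L[ℂ] H) ≤ a := ha
  have hmem : U a ∈ spectrum ℂ (a : H →L[ℂ] H) :=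
    (StarSubalgebra.spectrum_eq N.toStarSubalgebra (hS := N.instIsClosedCoe) (a := a)) ▸
      AlgHom.apply_mem_spectrum (WeakDual.CharacterSpace.toAlgHom U) a
  have hsa : IsSelfAdjoint (a : H →L[ℂ] H) := IsSelfAdjoint.of_nonneg ha'
  have him := hsa.im_eq_zero_of_mem_spectrum hmem
  have hre : 0 ≤ (U a).re := by
    refine spectrum_nonneg_of_nonneg (𝕜 := ℝ) ha' ?_
    rw [← spectrum.algebraMap_mem_iff ℂ]
    have : algebraMap ℝ ℂ (U a).re = U a := Complex.ext rfl him.symm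
    rwa [this]
  exact Complex.nonneg_iff.2 ⟨hre, him.symm⟩

variable (E : TracialExpectation hN) (U : WeakDual.characterSpace ℂ N)

theorem state_nonneg {x : M} (hx : 0 ≤ x) : 0 ≤ E.state U x :=
  character_nonneg U (E.map_nonneg x hx)

theorem state_mono {x y : M} (h : x ≤ y) : E.state U x ≤ E.state U y := by
  have h' : 0 ≤ y - x := by
    show (0 : H →L[ℂ] H) ≤ (y : H →L[ℂ] H) - x
    exact sub_nonneg.2 h
  have := E.state_nonneg U h'
  rwa [map_sub, sub_nonneg] at this

theorem star_mul_self_nonneg_coe (x : M) : 0 ≤ star x * x :=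
  star_mul_self_nonneg (x : H →L[ℂ] H)

theorem ideal_add {x y : M} (hx : E.state U (star x * x) = 0) (hy : E.state U (star y * y) = 0) :
    E.state U (star (x + y) * (x + y)) = 0 := by
  have h0 := E.state_nonneg U (star_mul_self_nonneg_coe (x + y))
  have h1 := E.state_nonneg U (star_mul_self_nonneg_coe (x - y))
  have h2 : E.state U (star (x + y) * (x + y)) + E.state U (star (x - y) * (x - y)) = 0 := by
    rw [← map_add, show star (x + y) * (x + y) + star (x - y) * (x - y)
      = (star x * x + star x * x) + (star y * y + star y * y) by
        simp only [star_add, star_sub]; noncomm_ring]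
    simp [hx, hy]
  exact ((add_eq_zero_iff_of_nonneg h0 h1).1 h2).1

theorem ideal_mul_left (a : M) {x : M} (hx : E.state U (star x * x) = 0) :
    E.state U (star (a * x) * (a * x)) = 0 := by
  have h0 := E.state_nonneg U (star_mul_self_nonneg_coe (a * x))
  have h1 : star (a * x) * (a * x) ≤ ((‖(a : H →L[ℂ] H)‖ ^ 2 : ℝ) : ℂ) • (star x * x) := by
    have h := star_left_conjugate_le_conjugate
      (CStarAlgebra.star_mul_le_algebraMap_norm_sq (a := (a : H →L[ℂ] H))) (x : H →L[ℂ] H)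
    show star ((a : H →L[ℂ] H) * x) * ((a : H →L[ℂ] H) * x) ≤
      ((‖(a : H →L[ℂ] H)‖ ^ 2 : ℝ) : ℂ) • (star (x : H →L[ℂ] H) * x)
    convert h using 1
    · simp [mul_assoc]
    · rw [Algebra.algebraMap_eq_smul_one]
      simp only [mul_smul_comm, smul_mul_assoc, mul_one]
      rw [Complex.coe_smul]
  have h2 := E.state_mono U h1
  rw [map_smul, hx, smul_zero] at h2
  exact le_antisymm h2 h0

/-- The ideal `{x ∈ M : U (E (x* x)) = 0}`. -/
def ultraIdeal : Ideal M where
  carrier := {x | E.state U (star x * x) = 0}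
  add_mem' hx hy := E.ideal_add U hx hy
  zero_mem' := by simp
  smul_mem' a _ hx := E.ideal_mul_left U a hx

theorem mem_ultraIdeal {x : M} :
    x ∈ E.ultraIdeal U ↔ U (E.toLinearMap (star x * x)) = 0 := Iff.rfl

theorem star_mem_ultraIdeal {x : M} (hx : x ∈ E.ultraIdeal U) : star x ∈ E.ultraIdeal U := by
  rw [mem_ultraIdeal] at hx ⊢
  rwa [star_star, E.tracial]

instance : (E.ultraIdeal U).IsTwoSided where
  mul_mem_of_left {x} b hx := by
    have h := E.star_mem_ultraIdeal U
      ((E.ultraIdeal U).mul_mem_left (star b) (E.star_mem_ultraIdeal U hx))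
    simpa using h

theorem state_eq_zero_of_mem {x : M} (hx : x ∈ E.ultraIdeal U) : E.state U x = 0 := by
  have hx' : E.state U (star x * x) = 0 := hx
  have key : ∀ c : ℂ, 0 ≤ - (c * E.state U (star x)) - star c * E.state U x
      + star c * c * E.state U 1 := by
    intro c
    have h := E.state_nonneg U (star_mul_self_nonneg_coe (x - c • (1 : M)))
    have e : star (x - c • (1 : M)) * (x - c • (1 : M)) =
        star x * x - c • star x - star c • x + (star c * c) • (1 : M) := by
      simp only [star_sub, star_smul, star_one, sub_mul, mul_sub, smul_mul_assoc,
        mul_smul_comm, one_mul, mul_one, smul_sub, smul_smul, mul_comm (star c) c]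
      abel
    rw [e, map_add, map_sub, map_sub, hx', map_smul, map_smul, map_smul] at h
    simpa using h
  have h1 : E.state U 1 = 1 := by
    have : E.toLinearMap 1 = 1 := E.map_incl 1
    rw [state_apply, this, map_one]
  have real_key : ∀ s : ℂ, (∀ t : ℝ, 0 ≤ -(t * s) + t * t) → s = 0 := by
    intro s hs
    have him : s.im = 0 := by
      have := (Complex.nonneg_iff.1 (hs 1)).2
      simpa using this
    have hre : s.re = 0 := by
      have := (Complex.nonneg_iff.1 (hs (s.re / 2))).1
      simp [him] at this
      nlinarith [sq_nonneg s.re]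
    exact Complex.ext hre him
  have hp : E.state U (star x) + E.state U x = 0 := by
    refine real_key _ fun t => ?_
    have h := key t
    rw [h1] at h
    convert h using 1
    simp
    ring
  have hm : Complex.I * (E.state U (star x) - E.state U x) = 0 := by
    refine real_key _ fun t => ?_
    have h := key (t * Complex.I)
    rw [h1] at h
    convert h using 1
    simp
    linear_combination (t : ℂ) * t * Complex.I_mul_I
  have hm' := (mul_eq_zero.1 hm).resolve_left Complex.I_ne_zero
  linear_combination (1 / 2 : ℂ) * hp - (1 / 2 : ℂ) * hm'

/-- The ultrafiber of `M` with respect to `E` and `U`: the quotient C*-algebra of `M` by the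
ideal `{x ∈ M : U (E (x* x)) = 0}`, with the quotient norm. -/
def Ultrafiber : Type u := M ⧸ E.ultraIdeal U

namespace Ultrafiber

instance : Ring (E.Ultrafiber U) := inferInstanceAs (Ring (M ⧸ E.ultraIdeal U))

instance : Algebra ℂ (E.Ultrafiber U) := inferInstanceAs (Algebra ℂ (M ⧸ E.ultraIdeal U))

/-- The quotient norm. -/
instance : Norm (E.Ultrafiber U) := inferInstanceAs (Norm (M ⧸ E.ultraIdeal U))

/-- The quotient map onto the ultrafiber. -/
def mk : M →ₐ[ℂ] E.Ultrafiber U := Ideal.Quotient.mkₐ ℂ (E.ultraIdeal U)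

theorem mk_surjective : Function.Surjective (mk E U) := Ideal.Quotient.mk_surjective

theorem mk_eq_mk_iff {x y : M} : mk E U x = mk E U y ↔ x - y ∈ E.ultraIdeal U :=
  Ideal.Quotient.eq

instance : Star (E.Ultrafiber U) where
  star := Quotient.lift (fun x : M => mk E U (star x)) fun x y h => by
    have h' : x - y ∈ E.ultraIdeal U := (Submodule.quotientRel_def _).1 h
    rw [mk_eq_mk_iff, ← star_sub]
    exact E.star_mem_ultraIdeal U h'

theorem mk_star (x : M) : mk E U (star x) = star (mk E U x) := rfl

instance : StarRing (E.Ultrafiber U) where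
  star_involutive a := by
    obtain ⟨x, rfl⟩ := mk_surjective E U a
    rw [← mk_star, ← mk_star, star_star]
  star_mul a b := by
    obtain ⟨x, rfl⟩ := mk_surjective E U a
    obtain ⟨y, rfl⟩ := mk_surjective E U b
    rw [← map_mul, ← mk_star, ← mk_star, ← mk_star, star_mul, map_mul]
  star_add a b := by
    obtain ⟨x, rfl⟩ := mk_surjective E U a
    obtain ⟨y, rfl⟩ := mk_surjective E U b
    rw [← map_add, ← mk_star, ← mk_star, ← mk_star, star_add, map_add]

/-- The canonical trace `x + I ↦ U (E x)` of the ultrafiber. -/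
def trace : E.Ultrafiber U →ₗ[ℂ] ℂ where
  toFun := Quotient.lift (fun x : M => U (E.toLinearMap x)) fun x y h => by
    have h' : x - y ∈ E.ultraIdeal U := (Submodule.quotientRel_def _).1 h
    have := E.state_eq_zero_of_mem U h'
    rwa [map_sub, sub_eq_zero] at this
  map_add' a b := by
    obtain ⟨x, rfl⟩ := mk_surjective E U a
    obtain ⟨y, rfl⟩ := mk_surjective E U b
    exact map_add (E.state U) x y
  map_smul' c a := by
    obtain ⟨x, rfl⟩ := mk_surjective E U a
    exact map_smul (E.state U) c x

theorem trace_mk (x : M) : trace E U (mk E U x) = U (E.toLinearMap x) := rfl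

end Ultrafiber

end TracialExpectation

/-! ### Formulas and their interpretations -/

/-- Formulas in the language of tracial von Neumann algebras with variables from `X`.
A non-commutative *-polynomial in the variables `X` is an element of the free algebra on
`X ⊕ X`, where `Sum.inl x` stands for `x` and `Sum.inr x` for its adjoint `x*`. -/
inductive TracialFormula (X : Type v) : Type v
  | reTr (p : FreeAlgebra ℂ (X ⊕ X)) : TracialFormula X
  | imTr (p : FreeAlgebra ℂ (X ⊕ X)) : TracialFormula X
  | connective {k : ℕ} (f : C(Fin k → ℝ, ℝ)) (φ : Fin k → TracialFormula X) : TracialFormula X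
  | sup (y : X) (φ : TracialFormula X) : TracialFormula X
  | inf (y : X) (φ : TracialFormula X) : TracialFormula X

/-- Evaluation of a non-commutative *-polynomial at an assignment of the variables. -/
def evalStarPolynomial {X : Type v} {A : Type u} [Ring A] [Algebra ℂ A] [Star A]
    (p : FreeAlgebra ℂ (X ⊕ X)) (x : X → A) : A :=
  FreeAlgebra.lift ℂ (Sum.elim x fun i => star (x i)) p

/-- The supremum of a set in a partially ordered set if it exists (and `0` otherwise). -/
def orderSup {P : Type u} [PartialOrder P] [Zero P] (S : Set P) : P :=
  open Classical in if h : ∃ z, IsLUB S z then h.choose else 0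

/-- The infimum of a set in a partially ordered set if it exists (and `0` otherwise). -/
def orderInf {P : Type u} [PartialOrder P] [Zero P] (S : Set P) : P :=
  open Classical in if h : ∃ z, IsGLB S z then h.choose else 0

namespace TracialFormula

variable {X : Type v} [DecidableEq X]

/-- The interpretation of a formula in a normed *-algebra `A` with trace `τ`, at an assignment
of the variables; the quantifiers range over the closed unit ball of `A`. -/
def interp {A : Type u} [Ring A] [Algebra ℂ A] [Star A] [Norm A] (τ : A →ₗ[ℂ] ℂ) :
    TracialFormula X → (X → A) → ℝ
  | reTr p, x => (τ (evalStarPolynomial p x)).re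
  | imTr p, x => (τ (evalStarPolynomial p x)).im
  | connective f φ, x => f fun i => (φ i).interp τ x
  | sup y φ, x => sSup {r | ∃ b : A, ‖b‖ ≤ 1 ∧ φ.interp τ (Function.update x y b) = r}
  | inf y φ, x => sInf {r | ∃ b : A, ‖b‖ ≤ 1 ∧ φ.interp τ (Function.update x y b) = r}

/-- The `N`-valued interpretation of a formula with respect to `E : M → N`, with values in the
self-adjoint part of `N`. Connectives act through the continuous functional calculus of `N`, and
suprema and infima over the closed unit ball of `M` are taken in the ordered set of self-adjoint
elements of `N`. -/
def interpE {H : Type u} [NormedAddCommGroup H] [InnerProductSpace ℂ H] [CompleteSpace H]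
    {N M : VonNeumannAlgebra H} {hN : N.IsCentralIn M} (E : TracialExpectation hN) :
    TracialFormula X → (X → M) → selfAdjoint N
  | reTr p, x => ℜ (E.toLinearMap (evalStarPolynomial p x))
  | imTr p, x => ℑ (E.toLinearMap (evalStarPolynomial p x))
  | connective f φ, x => hN.functionalCalculus f fun i => (φ i).interpE E x
  | sup y φ, x =>
      orderSup {z | ∃ b : M, ‖b‖ ≤ 1 ∧ φ.interpE E (Function.update x y b) = z}
  | inf y φ, x =>
      orderInf {z | ∃ b : M, ‖b‖ ≤ 1 ∧ φ.interpE E (Function.update x y b) = z}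

end TracialFormula

end

universe u v

/-! ### Characters and order in the central algebra -/

namespace VonNeumannAlgebra.IsCentralIn

open WeakDual

variable {H : Type u} [NormedAddCommGroup H] [InnerProductSpace ℂ H] [CompleteSpace H]
  {N M : VonNeumannAlgebra H}

/-! The proof is an induction on the formula. Atomic formulas agree by the definition of the trace
on the ultrafiber, and connectives agree because a character evaluates the functional calculus
pointwise. Only the quantifiers need work, and they rest on two facts.

First, the unit ball of `M` maps onto that of the ultrafiber (`exists_norm_le_one`), so both
quantifiers range over the same values. A lift `x` is truncated to `x g(x*x)` with `g(t) =
max(t,1)^(-1/2)`; the trace shows that `1 - g(x*x)` lies in the ideal.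

Second, `U` must commute with the suprema that occur (`IsLocal.isLUB_character`). A character need
not preserve infinite suprema, but the functions `b ↦ φ(b)` are local: the value on a projection of
`N` depends only on the part of `b` under it. Contractions can therefore be glued along central
projections, and a Zorn argument yields one contraction whose value is within `ε` of the supremum at
every character simultaneously (`IsLocal.exists_almost_sup`). Infima follow by negation.

Suprema exist because interpretations are bounded (`exists_bound_interpE`) and the self-adjoint part
of `N` is conditionally complete (`exists_isLUB`). This completeness and the chain condition in
Zorn's lemma both come from weak operator compactness along ultrafilters. -/

theorem character_functionalCalculus (hN : N.IsCentralIn M) (χ : characterSpace ℂ N) {k : ℕ}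
    (f : C(Fin k → ℝ, ℝ)) (a : Fin k → selfAdjoint N) :
    χ (hN.functionalCalculus f a : N) = ((f fun i => (χ (a i : N)).re : ℝ) : ℂ) := by
  let := hN.commCStarAlgebra
  have h := (gelfandStarTransform N).apply_symm_apply
    ⟨fun χ => ((f fun i => (χ (a i : N)).re : ℝ) : ℂ), by
        refine Complex.continuous_ofReal.comp (f.continuous.comp (continuous_pi fun i => ?_))
        exact Complex.continuous_re.comp (gelfandStarTransform N (a i : N)).continuous⟩
  exact DFunLike.congr_fun h χ

theorem character_ext (hN : N.IsCentralIn M) {a b : N}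
    (h : ∀ χ : characterSpace ℂ N, χ a = χ b) : a = b := by
  let := hN.commCStarAlgebra
  exact (gelfandStarTransform N).injective (ContinuousMap.ext h)

theorem norm_le_of_character (hN : N.IsCentralIn M) {a : N} {C : ℝ} (hC : 0 ≤ C)
    (h : ∀ χ : characterSpace ℂ N, ‖χ a‖ ≤ C) : ‖a‖ ≤ C := by
  let := hN.commCStarAlgebra
  have h1 : ‖gelfandTransform ℂ N a‖ ≤ C := (ContinuousMap.norm_le _ hC).2 h
  rwa [(AddMonoidHomClass.isometry_iff_norm (gelfandTransform ℂ N)).1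
    (gelfandTransform_isometry N) a] at h1

end VonNeumannAlgebra.IsCentralIn

namespace VonNeumannAlgebra

open WeakDual

variable {H : Type u} [NormedAddCommGroup H] [InnerProductSpace ℂ H] [CompleteSpace H]
  {N M : VonNeumannAlgebra H}

theorem character_selfAdjoint (χ : characterSpace ℂ N) (a : selfAdjoint N) :
    χ (a : N) = ((χ (a : N)).re : ℂ) := by
  have h : star (χ (a : N)) = χ (a : N) := by
    rw [← map_star, selfAdjoint.mem_iff.1 a.2]
  exact (Complex.conj_eq_iff_re.1 h).symm

theorem IsCentralIn.selfAdjoint_ext (hN : N.IsCentralIn M) {a b : selfAdjoint N}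
    (h : ∀ χ : characterSpace ℂ N, (χ (a : N)).re = (χ (b : N)).re) : a = b := by
  refine Subtype.ext (hN.character_ext fun χ => ?_)
  rw [character_selfAdjoint, h, ← character_selfAdjoint]

theorem coe_sub_nonneg_iff {a b : N} : 0 ≤ b - a ↔ a ≤ b :=
  sub_nonneg (a := (b : H →L[ℂ] H)) (b := (a : H →L[ℂ] H))

/-- The square root in the functional calculus exhibits `a` as `s* s`. This links the operator order
to the pointwise order on characters. -/
theorem IsCentralIn.nonneg_of_character (hN : N.IsCentralIn M) {a : selfAdjoint N}
    (h : ∀ χ : characterSpace ℂ N, 0 ≤ (χ (a : N)).re) : 0 ≤ a := by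
  let s := hN.functionalCalculus (k := 1) ⟨fun t => √(t 0), by fun_prop⟩ fun _ => a
  have hs : (a : N) = star (s : N) * s := by
    refine hN.character_ext fun χ => ?_
    rw [map_mul, selfAdjoint.mem_iff.1 s.2, hN.character_functionalCalculus,
      character_selfAdjoint]
    simp only [ContinuousMap.coe_mk, Complex.ofReal_re]
    rw [← Complex.ofReal_mul, Real.mul_self_sqrt (h χ)]
  change (0 : N) ≤ a
  rw [hs]
  exact TracialExpectation.star_mul_self_nonneg_coe _

theorem IsCentralIn.le_iff_character (hN : N.IsCentralIn M) {a b : selfAdjoint N} :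
    a ≤ b ↔ ∀ χ : characterSpace ℂ N, (χ (a : N)).re ≤ (χ (b : N)).re := by
  constructor
  · intro h χ
    have h1 : (0 : N) ≤ (b : N) - a := coe_sub_nonneg_iff.2 h
    have h2 := (Complex.nonneg_iff.1 (TracialExpectation.character_nonneg χ h1)).1
    simpa using h2
  · intro h
    have h1 : 0 ≤ b - a := hN.nonneg_of_character fun χ => by simpa using h χ
    exact coe_sub_nonneg_iff.1 h1

/-- Two self-adjoint elements of a central von Neumann subalgebra have a join. -/
theorem IsCentralIn.exists_isLUB_pair (hN : N.IsCentralIn M) (a b : selfAdjoint N) :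
    ∃ c, IsLUB {a, b} c := by
  refine ⟨hN.functionalCalculus (k := 2) ⟨fun t => max (t 0) (t 1), by fun_prop⟩ ![a, b], ?_, ?_⟩
  · rintro z (rfl | rfl) <;> refine hN.le_iff_character.2 fun χ => ?_ <;>
      simp [hN.character_functionalCalculus]
  · intro z hz
    refine hN.le_iff_character.2 fun χ => ?_
    have h1 := hN.le_iff_character.1 (hz (Set.mem_insert a {b})) χ
    have h2 := hN.le_iff_character.1 (hz (Set.mem_insert_of_mem a rfl)) χ
    simp [hN.character_functionalCalculus, h1, h2]

/-! ### Weak operator compactness -/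

open Filter Topology InnerProductSpace

/-- Along an ultrafilter, norm bounded families of operators converge weakly. -/
theorem exists_weak_limit_operator {ι : Type*} (F : Ultrafilter ι) {C : ℝ}
    (a : ι → H →L[ℂ] H) (ha : ∀ i, ‖a i‖ ≤ C) :
    ∃ b : H →L[ℂ] H, ‖b‖ ≤ C ∧
      ∀ ξ η, Tendsto (fun i => ⟪a i ξ, η⟫_ℂ) F (𝓝 ⟪b ξ, η⟫_ℂ) := by
  have hne : Nonempty ι := F.nonempty_of_mem univ_mem |>.to_type
  have hC : 0 ≤ C := (norm_nonneg _).trans (ha hne.some)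
  have hb : ∀ i ξ η, ‖⟪a i ξ, η⟫_ℂ‖ ≤ C * ‖ξ‖ * ‖η‖ := fun i ξ η =>
    (norm_inner_le_norm _ _).trans (by
      gcongr
      exact ((a i).le_opNorm ξ).trans (by gcongr; exact ha i))
  have hlim : ∀ ξ η, ∃ z, Tendsto (fun i => ⟪a i ξ, η⟫_ℂ) F (𝓝 z) := by
    intro ξ η
    obtain ⟨z, -, hz⟩ := (isCompact_closedBall (0 : ℂ) (C * ‖ξ‖ * ‖η‖)).ultrafilter_le_nhds'
      (F.map fun i => ⟪a i ξ, η⟫_ℂ)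
      (Ultrafilter.mem_map.2 (univ_mem' fun i => by simpa using hb i ξ η))
    exact ⟨z, hz⟩
  choose B hB using hlim
  -- The limits of matrix coefficients form a bounded sesquilinear form, which Riesz representation
  -- turns into an operator.
  let B₁ : H →ₗ⋆[ℂ] H →ₗ[ℂ] ℂ := LinearMap.mk₂'ₛₗ (starRingEnd ℂ) (RingHom.id ℂ) B
    (fun ξ ξ' η => tendsto_nhds_unique (hB _ _)
      (((hB ξ η).add (hB ξ' η)).congr fun i => by rw [map_add, inner_add_left]))
    (fun c ξ η => tendsto_nhds_unique (hB _ _)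
      (((hB ξ η).const_mul (starRingEnd ℂ c)).congr fun i => by
        rw [map_smul, inner_smul_left]))
    (fun ξ η η' => tendsto_nhds_unique (hB _ _)
      (((hB ξ η).add (hB ξ η')).congr fun i => by rw [inner_add_right]))
    (fun c ξ η => tendsto_nhds_unique (hB _ _)
      (((hB ξ η).const_mul c).congr fun i => by rw [inner_smul_right]))
  have hB₁ : ∀ ξ η, ‖B₁ ξ η‖ ≤ C * ‖ξ‖ * ‖η‖ := fun ξ η =>
    le_of_tendsto (hB ξ η).norm (Eventually.of_forall fun i => hb i ξ η)
  let b := continuousLinearMapOfBilin (B₁.mkContinuous₂ C hB₁)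
  have hbB : ∀ ξ η, ⟪b ξ, η⟫_ℂ = B ξ η := fun ξ η => continuousLinearMapOfBilin_apply _ ξ η
  refine ⟨b, ContinuousLinearMap.opNorm_le_bound _ hC fun ξ => ?_, fun ξ η => ?_⟩
  · by_cases h0 : ‖b ξ‖ = 0
    · rw [h0]; positivity
    · have h1 : ‖b ξ‖ * ‖b ξ‖ ≤ C * ‖ξ‖ * ‖b ξ‖ := by
        rw [← inner_self_eq_norm_mul_norm (𝕜 := ℂ)]
        exact (RCLike.re_le_norm _).trans ((congrArg norm (hbB ξ (b ξ))).trans_le (hB₁ _ _))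
      exact le_of_mul_le_mul_right h1 ((norm_nonneg _).lt_of_ne' h0)
  · rw [hbB]; exact hB ξ η

/-- Bounded families in a von Neumann algebra converge weakly along ultrafilters. -/
theorem exists_weak_limit (K : VonNeumannAlgebra H) {ι : Type*} (F : Ultrafilter ι) {C : ℝ}
    (a : ι → K) (ha : ∀ i, ‖a i‖ ≤ C) :
    ∃ b : K, ‖b‖ ≤ C ∧
      ∀ ξ η, Tendsto (fun i => ⟪(a i : H →L[ℂ] H) ξ, η⟫_ℂ) F (𝓝 ⟪(b : H →L[ℂ] H) ξ, η⟫_ℂ) := by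
  obtain ⟨b, hbC, hb⟩ := exists_weak_limit_operator F (fun i => (a i : H →L[ℂ] H)) ha
  -- By the bicommutant property it suffices that `b` commutes with `K'`; commutation with a fixed
  -- operator survives weak limits.
  have hbK : b ∈ K := by
    rw [← K.commutant_commutant, mem_commutant_iff]
    intro g hg
    have hcomm : ∀ i, (a i : H →L[ℂ] H) * g = g * a i := mem_commutant_iff.1 hg |> fun h i =>
      h (a i) (a i).2
    refine ContinuousLinearMap.ext fun ξ => ext_inner_right ℂ fun η => ?_
    refine tendsto_nhds_unique ?_ (hb (g ξ) η)
    have h2 := hb ξ (ContinuousLinearMap.adjoint g η)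
    simp only [ContinuousLinearMap.adjoint_inner_right] at h2
    refine h2.congr fun i => ?_
    have := DFunLike.congr_fun (hcomm i) ξ
    simp only [mul_apply_eq_comp] at this
    rw [this]
  exact ⟨⟨b, hbK⟩, hbC, hb⟩

end VonNeumannAlgebra

/-! ### Weak limits and conditional completeness -/

namespace VonNeumannAlgebra

open WeakDual Filter Topology InnerProductSpace

variable {H : Type u} [NormedAddCommGroup H] [InnerProductSpace ℂ H] [CompleteSpace H]
  {N M K : VonNeumannAlgebra H}

/-- Convergence of a family in a von Neumann algebra for the weak operator topology. -/
def TendstoWeakly {ι : Type*} (F : Filter ι) (a : ι → K) (b : K) : Prop :=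
  ∀ ξ η, Tendsto (fun i => ⟪(a i : H →L[ℂ] H) ξ, η⟫_ℂ) F (𝓝 ⟪(b : H →L[ℂ] H) ξ, η⟫_ℂ)

namespace TendstoWeakly

variable {ι : Type*} {F : Filter ι} {a a' : ι → K} {b b' : K}

theorem const (b : K) : TendstoWeakly F (fun _ => b) b := fun _ _ => tendsto_const_nhds

theorem unique [F.NeBot] (h : TendstoWeakly F a b) (h' : TendstoWeakly F a b') : b = b' :=
  Subtype.ext <| ContinuousLinearMap.ext fun ξ => ext_inner_right ℂ fun η =>
    tendsto_nhds_unique (h ξ η) (h' ξ η)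

theorem congr' (h : TendstoWeakly F a b) (haa' : ∀ᶠ i in F, a i = a' i) :
    TendstoWeakly F a' b := fun ξ η =>
  (h ξ η).congr' (haa'.mono fun i hi => by simp only [hi])

theorem sub (h : TendstoWeakly F a b) (h' : TendstoWeakly F a' b') :
    TendstoWeakly F (fun i => a i - a' i) (b - b') := fun ξ η => by
  have e : ∀ x y : K, ⟪((x - y : K) : H →L[ℂ] H) ξ, η⟫_ℂ =
      ⟪(x : H →L[ℂ] H) ξ, η⟫_ℂ - ⟪(y : H →L[ℂ] H) ξ, η⟫_ℂ := fun x y => inner_sub_left _ _ _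
  simp only [e]
  exact (h ξ η).sub (h' ξ η)

theorem star (h : TendstoWeakly F a b) :
    TendstoWeakly F (fun i => star (a i)) (Star.star b) := fun ξ η => by
  have e : ∀ x : K, ⟪((Star.star x : K) : H →L[ℂ] H) ξ, η⟫_ℂ =
      starRingEnd ℂ ⟪(x : H →L[ℂ] H) η, ξ⟫_ℂ := fun x => by
    rw [inner_conj_symm]
    exact ContinuousLinearMap.adjoint_inner_left _ _ _
  simp only [e]
  exact (Complex.continuous_conj.tendsto _).comp (h η ξ)

theorem mul_const (h : TendstoWeakly F a b) (c : K) :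
    TendstoWeakly F (fun i => a i * c) (b * c) := fun ξ η => h ((c : H →L[ℂ] H) ξ) η

theorem const_mul (h : TendstoWeakly F a b) (c : K) :
    TendstoWeakly F (fun i => c * a i) (c * b) := fun ξ η => by
  have e : ∀ x : K, ⟪((c * x : K) : H →L[ℂ] H) ξ, η⟫_ℂ =
      ⟪(x : H →L[ℂ] H) ξ, ((Star.star c : K) : H →L[ℂ] H) η⟫_ℂ := fun x =>
    (ContinuousLinearMap.adjoint_inner_right (c : H →L[ℂ] H) ((x : H →L[ℂ] H) ξ) η).symm
  simp only [e]
  exact h ξ _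

theorem nonneg [F.NeBot] (h : TendstoWeakly F a b) (ha : ∀ᶠ i in F, 0 ≤ a i) : 0 ≤ b := by
  change (0 : H →L[ℂ] H) ≤ b
  rw [ContinuousLinearMap.nonneg_iff_isPositive, ContinuousLinearMap.isPositive_iff_complex]
  intro ξ
  have hpos : ∀ᶠ i in F, ((⟪(a i : H →L[ℂ] H) ξ, ξ⟫_ℂ).re : ℂ) = ⟪(a i : H →L[ℂ] H) ξ, ξ⟫_ℂ ∧
      0 ≤ (⟪(a i : H →L[ℂ] H) ξ, ξ⟫_ℂ).re := ha.mono fun i hi =>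
    (ContinuousLinearMap.isPositive_iff_complex _).1
      ((ContinuousLinearMap.nonneg_iff_isPositive _).1
        (show (0 : H →L[ℂ] H) ≤ a i from hi)) ξ
  have hre := (Complex.continuous_re.tendsto _).comp (h ξ ξ)
  refine ⟨tendsto_nhds_unique_of_eventuallyEq
    ((Complex.continuous_ofReal.tendsto _).comp hre) (h ξ ξ) (hpos.mono fun i hi => hi.1), ?_⟩
  exact ge_of_tendsto hre (hpos.mono fun i hi => hi.2)

theorem selfAdjoint [F.NeBot] (h : TendstoWeakly F a b) (ha : ∀ i, IsSelfAdjoint (a i)) :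
    IsSelfAdjoint b :=
  h.star.unique (by simpa only [(ha _).star_eq] using h)

end TendstoWeakly

/-- The tails `{j | r i j}` are nonempty and downward directed, so they generate a proper filter,
which an ultrafilter refines. -/
theorem exists_ultrafilter_of_directed {α : Type*} [Nonempty α] {r : α → α → Prop}
    (hr : ∀ i j, ∃ k, r i k ∧ r j k) (htrans : ∀ i j k, r i j → r j k → r i k) :
    ∃ F : Ultrafilter α, ∀ i, ∀ᶠ j in F, r i j := by
  have hne : (⨅ i, 𝓟 {j | r i j}).NeBot := by
    refine iInf_neBot_of_directed (fun i j => ?_) fun i => principal_neBot_iff.2 ?_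
    · obtain ⟨k, hik, hjk⟩ := hr i j
      exact ⟨k, principal_mono.2 fun l hl => htrans _ _ _ hik hl,
        principal_mono.2 fun l hl => htrans _ _ _ hjk hl⟩
    · obtain ⟨k, hk, -⟩ := hr i i
      exact ⟨k, hk⟩
  exact ⟨Ultrafilter.of _, fun i => Ultrafilter.of_le _ (mem_iInf_of_mem i (mem_principal_self _))⟩

namespace IsCentralIn

/-- The self-adjoint part of a central von Neumann subalgebra is conditionally complete. -/
theorem exists_isLUB (hN : N.IsCentralIn M) {S : Set (selfAdjoint N)} (hS : S.Nonempty)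
    {C : ℝ} (hC : ∀ z ∈ S, ∀ χ : characterSpace ℂ N, |(χ (z : N)).re| ≤ C) :
    ∃ s, IsLUB S s := by
  obtain ⟨s₀, hs₀⟩ := hS
  by_cases hne : Nonempty (characterSpace ℂ N)
  swap
  -- Degenerate case: without characters `N` is trivial.
  · have hsub : ∀ a b : selfAdjoint N, a = b := fun a b =>
      hN.selfAdjoint_ext fun χ => (hne ⟨χ⟩).elim
    exact ⟨s₀, fun z _ => (hsub z s₀).le, fun z _ => (hsub s₀ z).le⟩
  have hC0 : 0 ≤ C := (abs_nonneg _).trans (hC s₀ hs₀ hne.some)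
  -- `T` is closed under joins, also with elements of `S`, and norm bounded, the lower bound coming
  -- from `s₀`. Its weak limit along the tails is the supremum of `S`.
  let T : Set (selfAdjoint N) := {z | s₀ ≤ z ∧ ∀ u ∈ upperBounds S, z ≤ u}
  have hT₀ : s₀ ∈ T := ⟨le_rfl, fun u hu => hu hs₀⟩
  have : Nonempty T := ⟨⟨s₀, hT₀⟩⟩
  have hjoin : ∀ z w : selfAdjoint N, z ∈ T → (∀ u ∈ upperBounds S, w ≤ u) →
      ∃ t ∈ T, z ≤ t ∧ w ≤ t := by
    intro z w hz hw
    obtain ⟨c, hc⟩ := hN.exists_isLUB_pair z w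
    have hzc : z ≤ c := hc.1 (Set.mem_insert _ _)
    refine ⟨c, ⟨hz.1.trans hzc, fun u hu => hc.2 ?_⟩, hzc, hc.1 (Set.mem_insert_of_mem _ rfl)⟩
    rintro v (rfl | rfl)
    exacts [hz.2 u hu, hw u hu]
  obtain ⟨F, hF⟩ := exists_ultrafilter_of_directed (α := T) (r := (· ≤ ·))
    (fun i j => by
      obtain ⟨t, ht, h1, h2⟩ := hjoin i j i.2 j.2.2
      exact ⟨⟨t, ht⟩, h1, h2⟩) fun i j k => le_trans
  let cst : selfAdjoint N := ⟨algebraMap ℂ N C, by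
    rw [selfAdjoint.mem_iff, ← algebraMap_star_comm]; simp⟩
  have hcst : cst ∈ upperBounds S := fun z hz => hN.le_iff_character.2 fun χ => by
    simpa [cst, AlgHomClass.commutes] using (abs_le.1 (hC z hz χ)).2
  have hbd : ∀ i : T, ‖((i : selfAdjoint N) : N)‖ ≤ C := fun i =>
    hN.norm_le_of_character hC0 fun χ => by
      rw [character_selfAdjoint, Complex.norm_real, Real.norm_eq_abs, abs_le]
      have h1 := hN.le_iff_character.1 i.2.1 χ
      have h2 := hN.le_iff_character.1 (i.2.2 cst hcst) χ
      have h3 := (abs_le.1 (hC s₀ hs₀ χ)).1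
      exact ⟨h3.trans h1, by simpa [cst, AlgHomClass.commutes] using h2⟩
  obtain ⟨t, -, ht⟩ := N.exists_weak_limit F (fun i : T => ((i : selfAdjoint N) : N)) hbd
  change TendstoWeakly _ _ _ at ht
  refine ⟨⟨t, ht.selfAdjoint fun i => i.1.2⟩, fun z hz => ?_, fun u hu => ?_⟩
  · obtain ⟨w, hw, -, hzw⟩ := hjoin s₀ z hT₀ fun u hu => hu hz
    refine coe_sub_nonneg_iff.1 ((ht.sub (TendstoWeakly.const (z : N))).nonneg ?_)
    exact (hF ⟨w, hw⟩).mono fun i hi => coe_sub_nonneg_iff.2 (hzw.trans hi)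
  · refine coe_sub_nonneg_iff.1 (((TendstoWeakly.const (u : N)).sub ht).nonneg ?_)
    exact Eventually.of_forall fun i => coe_sub_nonneg_iff.2 (i.2.2 u hu)

theorem character_eq_zero_or_one {p : N} (hp : IsStarProjection p) (χ : characterSpace ℂ N) :
    χ p = 0 ∨ χ p = 1 := by
  have h : χ p * χ p = χ p := by rw [← map_mul, hp.isIdempotentElem.eq]
  exact IsIdempotentElem.iff_eq_zero_or_one.1 h

end IsCentralIn

end VonNeumannAlgebra

/-! ### Central projections, gluing and almost attained suprema -/

namespace VonNeumannAlgebra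

open WeakDual Filter Topology

variable {H : Type u} [NormedAddCommGroup H] [InnerProductSpace ℂ H] [CompleteSpace H]
  {N M K : VonNeumannAlgebra H}

namespace IsCentralIn

/-- The support projection of the positive part of a self-adjoint element. -/
theorem exists_support_projection (hN : N.IsCentralIn M) {a : selfAdjoint N} (ha : ¬ a ≤ 0) :
    ∃ q : N, IsStarProjection q ∧ q ≠ 0 ∧
      (∀ χ : characterSpace ℂ N, χ q = 1 → 0 ≤ (χ (a : N)).re) ∧
      ∀ z : N, z * a = 0 → z * q = 0 := by
  let c := hN.functionalCalculus (k := 1) ⟨fun t => max (t 0) 0, by fun_prop⟩ fun _ => a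
  let d := hN.functionalCalculus (k := 1) ⟨fun t => min (t 0) 0, by fun_prop⟩ fun _ => a
  have hc : ∀ χ : characterSpace ℂ N, χ (c : N) = ((max (χ (a : N)).re 0 : ℝ) : ℂ) := fun χ =>
    hN.character_functionalCalculus χ _ _
  have hd : ∀ χ : characterSpace ℂ N, χ (d : N) = ((min (χ (a : N)).re 0 : ℝ) : ℂ) := fun χ =>
    hN.character_functionalCalculus χ _ _
  -- `c` and `d` are `max(a,0)` and `min(a,0)`, and `q` is the range projection of `c`. It lies in
  -- `N` since the closed range of `c` is invariant under the commutant of `N`.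
  let T : H →L[ℂ] H := (c : N)
  let L : Submodule ℂ H := T.range.topologicalClosure
  have hL : IsStarProjection L.starProjection := isStarProjection_starProjection
  have hLrange : L.starProjection.range = L := Submodule.range_starProjection L
  have hqN : L.starProjection ∈ N := by
    rw [IsStarProjection.mem_iff hL]
    intro y hy
    rw [hLrange, Module.End.mem_invtSubmodule]
    refine Submodule.topologicalClosure_minimal _ ?_
      ((Submodule.isClosed_topologicalClosure _).preimage y.continuous)
    rintro _ ⟨ξ, rfl⟩
    refine subset_closure ⟨y ξ, ?_⟩
    exact DFunLike.congr_fun (mem_commutant_iff.1 hy T (c : N).2) ξ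
  let q : N := ⟨L.starProjection, hqN⟩
  have hq : IsStarProjection q :=
    ⟨Subtype.ext hL.isIdempotentElem, Subtype.ext hL.isSelfAdjoint⟩
  have hqc : q * c = c := by
    refine Subtype.ext (ContinuousLinearMap.ext fun ξ => ?_)
    exact Submodule.starProjection_eq_self_iff.2 (subset_closure ⟨ξ, rfl⟩)
  have hkill : ∀ z : N, z * c = 0 → z * q = 0 := by
    intro z hz
    refine Subtype.ext (ContinuousLinearMap.ext fun ξ => ?_)
    have hker : L ≤ (z : H →L[ℂ] H).ker := by
      refine Submodule.topologicalClosure_minimal _ ?_ (z : H →L[ℂ] H).isClosed_ker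
      rintro _ ⟨η, rfl⟩
      exact DFunLike.congr_fun (congrArg Subtype.val hz) η
    exact hker (L.starProjection_apply_mem ξ)
  refine ⟨q, hq, fun h0 => ha (hN.le_iff_character.2 fun χ => ?_), fun χ hχ => ?_, fun z hz => ?_⟩
  · have h1 : χ (c : N) = 0 := by rw [← hqc, h0, zero_mul, map_zero]
    rw [hc, Complex.ofReal_eq_zero] at h1
    simpa using h1.le
  -- Since `d c = 0`, also `d q = 0`, so `min(a,0)` vanishes at every character where `q` is `1`.
  · have h1 : (d : N) * q = 0 := hkill _ (hN.character_ext fun χ => by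
      rw [map_mul, hc, hd, ← Complex.ofReal_mul]
      rcases le_total (χ (a : N)).re 0 with h | h <;> simp [h])
    have h2 := congrArg χ h1
    rw [map_mul, hχ, mul_one, map_zero, hd, Complex.ofReal_eq_zero] at h2
    exact min_eq_right_iff.1 h2
  · refine hkill z (hN.character_ext fun χ => ?_)
    have h1 := congrArg χ hz
    rw [map_mul, map_zero] at h1 ⊢
    rcases mul_eq_zero.1 h1 with h | h
    · rw [h, zero_mul]
    · rw [hc, h]; simp

/-- Gluing two contractions along a projection gives a contraction. -/
theorem norm_glue_le (hN : N.IsCentralIn M) {p : N} (hp : IsStarProjection p) {b c : M}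
    (hb : ‖b‖ ≤ 1) (hc : ‖c‖ ≤ 1) : ‖hN.incl p * b + hN.incl (1 - p) * c‖ ≤ 1 := by
  let P : H →L[ℂ] H := p
  let B : H →L[ℂ] H := b
  let C : H →L[ℂ] H := c
  have hPB : ∀ ξ, P (B ξ) = B (P ξ) := fun ξ =>
    DFunLike.congr_fun (congrArg Subtype.val (hN.incl_mul_comm p b)) ξ
  have hPC : ∀ ξ, C ξ - P (C ξ) = C (ξ - P ξ) := fun ξ => by
    rw [map_sub]
    congr 1
    exact DFunLike.congr_fun (congrArg Subtype.val (hN.incl_mul_comm p c)) ξ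
  have hPP : ∀ ξ, P (P ξ) = P ξ := fun ξ =>
    DFunLike.congr_fun (congrArg Subtype.val hp.isIdempotentElem.eq) ξ
  have horth : ∀ ξ η, inner ℂ (P ξ) (η - P η) = 0 := fun ξ η => by
    have hPa : ContinuousLinearMap.adjoint P = P :=
      congrArg Subtype.val hp.isSelfAdjoint.star_eq
    rw [← ContinuousLinearMap.adjoint_inner_right, hPa, map_sub, hPP, sub_self, inner_zero_right]
  change ‖P * B + (1 - P) * C‖ ≤ 1
  refine ContinuousLinearMap.opNorm_le_bound _ zero_le_one fun ξ => ?_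
  -- Pythagoras on the ranges of `P` and `1 - P`, for the image and for `ξ` itself.
  have h1 := norm_add_sq_eq_norm_sq_add_norm_sq_of_inner_eq_zero _ _ (horth (B ξ) (C ξ))
  have h2 := norm_add_sq_eq_norm_sq_add_norm_sq_of_inner_eq_zero _ _ (horth ξ ξ)
  rw [add_sub_cancel] at h2
  have h3 : ‖P (B ξ)‖ ≤ ‖P ξ‖ := by
    rw [hPB]; exact (B.le_opNorm _).trans (mul_le_of_le_one_left (norm_nonneg _) hb)
  have h4 : ‖C ξ - P (C ξ)‖ ≤ ‖ξ - P ξ‖ := by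
    rw [hPC]; exact (C.le_opNorm _).trans (mul_le_of_le_one_left (norm_nonneg _) hc)
  rw [one_mul]
  change ‖P (B ξ) + (C ξ - P (C ξ))‖ ≤ ‖ξ‖
  nlinarith [norm_nonneg (P (B ξ) + (C ξ - P (C ξ))), norm_nonneg ξ, norm_nonneg (P (B ξ)),
    norm_nonneg (C ξ - P (C ξ))]

/-- A map on `M` is local over the central subalgebra `N` if it is compatible with cutting down by
projections of `N`. -/
def IsLocal (hN : N.IsCentralIn M) (f : M → selfAdjoint N) : Prop :=
  ∀ p : N, IsStarProjection p → ∀ b c : M, hN.incl p * b = hN.incl p * c →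
    ∀ χ : characterSpace ℂ N, χ p = 1 → χ (f b : N) = χ (f c : N)

/-- Suprema of local functions over the unit ball are approximately attained, uniformly over all
characters. -/
theorem IsLocal.exists_almost_sup {hN : N.IsCentralIn M} {f : M → selfAdjoint N}
    (hf : hN.IsLocal f) {s : selfAdjoint N} (hs : IsLUB {z | ∃ b : M, ‖b‖ ≤ 1 ∧ f b = z} s)
    {ε : ℝ} (hε : 0 < ε) :
    ∃ b : M, ‖b‖ ≤ 1 ∧ ∀ χ : characterSpace ℂ N, (χ (s : N)).re - ε ≤ (χ (f b : N)).re := by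
  -- Partial solutions `(p, b)`: the contraction `b` is almost optimal on `p`. The relation `r` says
  -- that the second pair extends the first; it is only a preorder, since `b` is arbitrary off `p`.
  let good : Set (N × M) := {x | IsStarProjection x.1 ∧ ‖x.2‖ ≤ 1 ∧
    ∀ χ : characterSpace ℂ N, χ x.1 = 1 → (χ (s : N)).re - ε ≤ (χ (f x.2 : N)).re}
  let r : good → good → Prop := fun x y => x.1.1 * y.1.1 = x.1.1 ∧
    hN.incl x.1.1 * y.1.2 = hN.incl x.1.1 * x.1.2
  have incl_mul : ∀ a b : N, hN.incl (a * b) = hN.incl a * hN.incl b := fun _ _ => rfl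
  have hrefl : ∀ x, r x x := fun x => ⟨x.2.1.isIdempotentElem.eq, rfl⟩
  have htrans : ∀ x y z, r x y → r y z → r x z := by
    rintro x y z ⟨h1, h2⟩ ⟨h3, h4⟩
    refine ⟨by rw [← h1, mul_assoc, h3], ?_⟩
    rw [← h2, ← h1, incl_mul, mul_assoc, mul_assoc, h4]
  let scal : ℝ → selfAdjoint N := fun t => ⟨algebraMap ℂ N t, by
    rw [selfAdjoint.mem_iff, ← algebraMap_star_comm]; simp⟩
  have hscal : ∀ (χ : characterSpace ℂ N) (t : ℝ), χ (scal t : N) = t := fun χ t =>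
    AlgHomClass.commutes χ (t : ℂ)
  have hcomm : ∀ a b : N, a * b = b * a := fun a b => hN.commCStarAlgebra.mul_comm a b
  have hchain : ∀ c : Set good, IsChain r c → ∃ ub, ∀ a ∈ c, r a ub := by
    intro c hc
    rcases c.eq_empty_or_nonempty with rfl | ⟨x₀, hx₀⟩
    -- The zero projection imposes no condition, as no character sends `0` to `1`.
    · exact ⟨⟨(0, 0), ⟨⟨zero_mul _, star_zero _⟩, by simp, fun χ h => by simp at h⟩⟩, by simp⟩
    have : Nonempty c := ⟨⟨x₀, hx₀⟩⟩
    obtain ⟨F, hF⟩ := exists_ultrafilter_of_directed (α := c) (r := fun x y => r x y)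
      (fun x y => by
        by_cases hxy : x = y
        · exact ⟨x, hrefl _, hxy ▸ hrefl _⟩
        rcases hc x.2 y.2 (fun h => hxy (Subtype.ext h)) with h | h
        · exact ⟨y, h, hrefl _⟩
        · exact ⟨x, hrefl _, h⟩) fun x y z => htrans _ _ _
    obtain ⟨b, hb1, hb⟩ := M.exists_weak_limit F (fun x : c => x.1.1.2) fun x => x.1.2.2.1
    obtain ⟨p, -, hp⟩ := N.exists_weak_limit F (fun x : c => x.1.1.1) (C := 1) fun x =>
      IsStarProjection.norm_le _ x.1.2.1
    change TendstoWeakly _ _ _ at hb hp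
    have hpp : ∀ x : c, x.1.1.1 * p = x.1.1.1 := fun x =>
      (hp.const_mul x.1.1.1).unique
        ((TendstoWeakly.const x.1.1.1).congr' ((hF x).mono fun y hy => hy.1.symm))
    have hpb : ∀ x : c, hN.incl x.1.1.1 * b = hN.incl x.1.1.1 * x.1.1.2 := fun x =>
      (hb.const_mul (hN.incl x.1.1.1)).unique
        ((TendstoWeakly.const (hN.incl x.1.1.1 * x.1.1.2)).congr'
          ((hF x).mono fun y hy => hy.2.symm))
    have hpproj : IsStarProjection p :=
      ⟨(hp.mul_const p).unique (by simpa only [hpp] using hp),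
        hp.selfAdjoint fun x => x.1.2.1.isSelfAdjoint⟩
    refine ⟨⟨(p, b), hpproj, hb1, fun χ hχ => ?_⟩, fun x hx => ⟨hpp ⟨x, hx⟩, hpb ⟨x, hx⟩⟩⟩
    let g : selfAdjoint N := f b - s + scal ε
    have hg : ∀ χ : characterSpace ℂ N,
        (χ (g : N)).re = (χ (f b : N)).re - (χ (s : N)).re + ε := fun χ => by
      simp [g, hscal]
    -- Characters need not be weakly continuous, so almost optimality is encoded as the operator
    -- inequality `0 ≤ p g`, which passes to weak limits. For each member of the chain, locality
    -- replaces `f b` by the value at its own contraction.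
    have hpos : (0 : N) ≤ p * g := by
      refine (hp.mul_const (g : N)).nonneg (Eventually.of_forall fun x => ?_)
      have hsa : IsSelfAdjoint (x.1.1.1 * (g : N)) := by
        rw [isSelfAdjoint_iff, star_mul, x.1.2.1.isSelfAdjoint.star_eq,
          selfAdjoint.mem_iff.1 g.2, hcomm]
      refine hN.nonneg_of_character (a := ⟨_, hsa⟩) fun ψ => ?_
      change 0 ≤ (ψ (x.1.1.1 * (g : N))).re
      rw [map_mul]
      rcases character_eq_zero_or_one x.1.2.1 ψ with h | h
      · simp [h]
      · rw [h, one_mul, hg, hf _ x.1.2.1 _ _ (hpb x) ψ h]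
        linarith [x.1.2.2.2 ψ h]
    have h1 := (Complex.nonneg_iff.1 (TracialExpectation.character_nonneg χ hpos)).1
    rw [map_mul, hχ, one_mul, hg] at h1
    linarith
  obtain ⟨m, hm⟩ := exists_maximal_of_chains_bounded hchain fun {x y z} => htrans x y z
  obtain ⟨⟨p, b⟩, hp, hb1, hpb⟩ := m
  have hp1 : p = 1 := by
    by_contra hne
    have hp' : IsStarProjection (1 - p) := hp.one_sub
    obtain ⟨c, hc1, hc⟩ : ∃ c : M, ‖c‖ ≤ 1 ∧
        ¬ ∀ χ : characterSpace ℂ N, χ p = 0 → (χ (f c : N)).re ≤ (χ (s : N)).re - ε := by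
      by_contra! hall
      -- If no contraction beat `s - ε` anywhere off `p`, then `s - ε(1 - p)` would be an upper
      -- bound, forcing `p = 1`.
      let w : selfAdjoint N := s - ⟨algebraMap ℂ N ε * (1 - p), by
        rw [selfAdjoint.mem_iff, star_mul, hp'.isSelfAdjoint.star_eq, ← algebraMap_star_comm]
        simp [hcomm]⟩
      have hw : ∀ χ : characterSpace ℂ N,
          (χ (w : N)).re = (χ (s : N)).re - (ε * (1 - χ p)).re := fun χ => by
        have : χ (algebraMap ℂ N ε) = ε := AlgHomClass.commutes χ (ε : ℂ)
        simp [w, map_mul, this]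
      have hsw : s ≤ w := hs.2 (by
        rintro _ ⟨c, hc1, rfl⟩
        refine hN.le_iff_character.2 fun χ => ?_
        rw [hw]
        rcases character_eq_zero_or_one hp χ with h | h
        · simpa [h] using hall c hc1 χ h
        · simpa [h] using hN.le_iff_character.1 (hs.1 ⟨c, hc1, rfl⟩) χ)
      refine hne (hN.character_ext fun χ => ?_)
      rcases character_eq_zero_or_one hp χ with h | h
      · have h1 := hN.le_iff_character.1 hsw χ
        rw [hw, h] at h1
        simp at h1
        linarith
      · rw [h, map_one]
    let a : selfAdjoint N := ⟨(1 - p) * ((f c - s + scal ε : selfAdjoint N) : N), by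
      rw [selfAdjoint.mem_iff, star_mul, hp'.isSelfAdjoint.star_eq, hcomm]
      rw [selfAdjoint.mem_iff.1 (f c - s + scal ε).2]⟩
    have ha : ∀ χ : characterSpace ℂ N, χ p = 0 →
        (χ (a : N)).re = (χ (f c : N)).re - (χ (s : N)).re + ε := fun χ h => by
      simp [a, h, hscal]
    have ha0 : ¬ a ≤ 0 := fun h => hc fun χ hχ => by
      have := hN.le_iff_character.1 h χ
      rw [ha χ hχ] at this
      simp at this
      linarith
    -- On this nonzero `q`, orthogonal to `p`, the contraction `c` is almost optimal; gluing `b` and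
    -- `c` extends the pair to `p + q`, against maximality.
    obtain ⟨q, hq, hq0, hqa, hqz⟩ := hN.exists_support_projection ha0
    have hpq : p * q = 0 := hqz p (by
      change p * ((1 - p) * _) = 0
      rw [← mul_assoc, mul_sub, mul_one, hp.isIdempotentElem.eq, sub_self, zero_mul])
    have hpq' : IsStarProjection (p + q) := hp.add hq hpq
    let d : M := hN.incl p * b + hN.incl (1 - p) * c
    have hpd : hN.incl p * d = hN.incl p * b := by
      simp only [d, mul_add, ← mul_assoc, ← incl_mul, hp.isIdempotentElem.eq]
      rw [show p * (1 - p) = 0 by rw [mul_sub, mul_one, hp.isIdempotentElem.eq, sub_self]]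
      rw [show hN.incl 0 = 0 from rfl, zero_mul, add_zero]
    have hqp : q * p = 0 := by rw [hcomm, hpq]
    have hqd : hN.incl q * d = hN.incl q * c := by
      simp only [d, mul_add, ← mul_assoc, ← incl_mul, hqp, mul_sub, mul_one, sub_zero]
      rw [show hN.incl 0 = 0 from rfl, zero_mul, zero_add]
    let y : good := ⟨(p + q, d), hpq', hN.norm_glue_le hp hb1 hc1, fun χ hχ => by
      rcases character_eq_zero_or_one hp χ with h | h
      · have hχq : χ q = 1 := by simpa [h] using hχ
        have h1 := hqa χ hχq
        rw [ha χ h] at h1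
        change _ ≤ (χ (f d : N)).re
        rw [hf q hq d c hqd χ hχq]
        linarith
      · change _ ≤ (χ (f d : N)).re
        rw [hf p hp d b hpd χ h]
        exact hpb χ h⟩
    have hy := (hm y ⟨by
      change p * (p + q) = p
      rw [mul_add, hp.isIdempotentElem.eq, hpq, add_zero], hpd⟩).1
    change (p + q) * p = p + q at hy
    rw [add_mul, hp.isIdempotentElem.eq, hqp, add_zero] at hy
    exact hq0 (by simpa using hy.symm)
  exact ⟨b, hb1, fun χ => hpb χ (by rw [hp1, map_one])⟩

end IsCentralIn

end VonNeumannAlgebra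

/-! ### Consequences of locality; estimates for characters composed with the expectation -/

section

open WeakDual

variable {H : Type u} [NormedAddCommGroup H] [InnerProductSpace ℂ H] [CompleteSpace H]
  {N M : VonNeumannAlgebra H} {hN : N.IsCentralIn M}

namespace VonNeumannAlgebra.IsCentralIn

theorem neg_le_neg_iff_selfAdjoint (hN : N.IsCentralIn M) {a b : selfAdjoint N} : -a ≤ -b ↔ b ≤ a := by
  simp [hN.le_iff_character]

theorem isLUB_neg_of_isGLB (hN : N.IsCentralIn M) {f : M → selfAdjoint N} {s : selfAdjoint N}
    (hs : IsGLB {z | ∃ b : M, ‖b‖ ≤ 1 ∧ f b = z} s) :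
    IsLUB {z | ∃ b : M, ‖b‖ ≤ 1 ∧ -f b = z} (-s) := by
  constructor
  · rintro _ ⟨b, hb, rfl⟩
    exact hN.neg_le_neg_iff_selfAdjoint.2 (hs.1 ⟨b, hb, rfl⟩)
  · intro u hu
    rw [← neg_neg u, hN.neg_le_neg_iff_selfAdjoint]
    refine hs.2 ?_
    rintro _ ⟨b, hb, rfl⟩
    rw [← hN.neg_le_neg_iff_selfAdjoint, neg_neg]
    exact hu ⟨b, hb, rfl⟩

theorem isGLB_of_isLUB_neg (hN : N.IsCentralIn M) {f : M → selfAdjoint N} {s : selfAdjoint N}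
    (hs : IsLUB {z | ∃ b : M, ‖b‖ ≤ 1 ∧ -f b = z} s) :
    IsGLB {z | ∃ b : M, ‖b‖ ≤ 1 ∧ f b = z} (-s) := by
  constructor
  · rintro _ ⟨b, hb, rfl⟩
    rw [← hN.neg_le_neg_iff_selfAdjoint, neg_neg]
    exact hs.1 ⟨b, hb, rfl⟩
  · intro u hu
    rw [← hN.neg_le_neg_iff_selfAdjoint, neg_neg]
    refine hs.2 ?_
    rintro _ ⟨b, hb, rfl⟩
    exact hN.neg_le_neg_iff_selfAdjoint.2 (hu ⟨b, hb, rfl⟩)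

theorem IsLocal.neg {f : M → selfAdjoint N} (hf : hN.IsLocal f) : hN.IsLocal fun b => -f b :=
  fun p hp b c h χ hχ => by simpa using hf p hp b c h χ hχ

/-- Characters commute with suprema of local functions over the unit ball. -/
theorem IsLocal.isLUB_character {f : M → selfAdjoint N} (hf : hN.IsLocal f) {s : selfAdjoint N}
    (hs : IsLUB {z | ∃ b : M, ‖b‖ ≤ 1 ∧ f b = z} s) (χ : characterSpace ℂ N) :
    IsLUB {r : ℝ | ∃ b : M, ‖b‖ ≤ 1 ∧ (χ (f b : N)).re = r} (χ (s : N)).re := by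
  constructor
  · rintro _ ⟨b, hb, rfl⟩
    exact hN.le_iff_character.1 (hs.1 ⟨b, hb, rfl⟩) χ
  · intro u hu
    refine le_of_forall_pos_sub_le fun ε hε => ?_
    obtain ⟨b, hb, h⟩ := hf.exists_almost_sup hs hε
    exact (h χ).trans (hu ⟨b, hb, rfl⟩)

theorem IsLocal.isGLB_character {f : M → selfAdjoint N} (hf : hN.IsLocal f) {s : selfAdjoint N}
    (hs : IsGLB {z | ∃ b : M, ‖b‖ ≤ 1 ∧ f b = z} s) (χ : characterSpace ℂ N) :
    IsGLB {r : ℝ | ∃ b : M, ‖b‖ ≤ 1 ∧ (χ (f b : N)).re = r} (χ (s : N)).re := by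
  have h := hf.neg.isLUB_character (hN.isLUB_neg_of_isGLB hs) χ
  have e : ∀ a : selfAdjoint N, (χ ((-a : selfAdjoint N) : N)).re = -(χ (a : N)).re := by simp
  simp only [e] at h
  refine ⟨?_, fun u hu => neg_le_neg_iff.1 (h.2 ?_)⟩
  · rintro _ ⟨b, hb, rfl⟩
    exact neg_le_neg_iff.1 (h.1 ⟨b, hb, rfl⟩)
  · rintro _ ⟨b, hb, rfl⟩
    exact neg_le_neg (hu ⟨b, hb, rfl⟩)

theorem abs_character_isLUB_le (hN : N.IsCentralIn M) {f : M → selfAdjoint N} {C : ℝ}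
    (hC : ∀ b : M, ‖b‖ ≤ 1 → ∀ χ : characterSpace ℂ N, |(χ (f b : N)).re| ≤ C) {s : selfAdjoint N}
    (hs : IsLUB {z | ∃ b : M, ‖b‖ ≤ 1 ∧ f b = z} s) (χ : characterSpace ℂ N) :
    |(χ (s : N)).re| ≤ C := by
  let c : selfAdjoint N := ⟨algebraMap ℂ N C, by
    rw [selfAdjoint.mem_iff, ← algebraMap_star_comm]; simp⟩
  have hc : ∀ ψ : characterSpace ℂ N, (ψ (c : N)).re = C := fun ψ => by
    simp [c, AlgHomClass.commutes]
  have h0 : ‖(0 : M)‖ ≤ 1 := by simp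
  refine abs_le.2 ⟨(abs_le.1 (hC 0 h0 χ)).1.trans
    (hN.le_iff_character.1 (hs.1 ⟨0, h0, rfl⟩) χ), ?_⟩
  have hsc : s ≤ c := hs.2 (by
    rintro _ ⟨b, hb, rfl⟩
    exact hN.le_iff_character.2 fun ψ => by rw [hc]; exact (abs_le.1 (hC b hb ψ)).2)
  simpa only [hc] using hN.le_iff_character.1 hsc χ

theorem abs_character_isGLB_le (hN : N.IsCentralIn M) {f : M → selfAdjoint N} {C : ℝ}
    (hC : ∀ b : M, ‖b‖ ≤ 1 → ∀ χ : characterSpace ℂ N, |(χ (f b : N)).re| ≤ C) {s : selfAdjoint N}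
    (hs : IsGLB {z | ∃ b : M, ‖b‖ ≤ 1 ∧ f b = z} s) (χ : characterSpace ℂ N) :
    |(χ (s : N)).re| ≤ C := by
  simpa using hN.abs_character_isLUB_le (f := fun b => -f b) (by simpa using hC)
    (hN.isLUB_neg_of_isGLB hs) χ

theorem isLUB_orderSup (hN : N.IsCentralIn M) {f : M → selfAdjoint N} {C : ℝ}
    (hC : ∀ b : M, ‖b‖ ≤ 1 → ∀ χ : characterSpace ℂ N, |(χ (f b : N)).re| ≤ C) :
    IsLUB {z | ∃ b : M, ‖b‖ ≤ 1 ∧ f b = z} (orderSup {z | ∃ b : M, ‖b‖ ≤ 1 ∧ f b = z}) := by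
  have h : ∃ z, IsLUB {z | ∃ b : M, ‖b‖ ≤ 1 ∧ f b = z} z :=
    hN.exists_isLUB ⟨f 0, 0, by simp, rfl⟩ (C := C) (by rintro _ ⟨b, hb, rfl⟩; exact hC b hb)
  rw [orderSup, dif_pos h]
  exact h.choose_spec

theorem isGLB_orderInf (hN : N.IsCentralIn M) {f : M → selfAdjoint N} {C : ℝ}
    (hC : ∀ b : M, ‖b‖ ≤ 1 → ∀ χ : characterSpace ℂ N, |(χ (f b : N)).re| ≤ C) :
    IsGLB {z | ∃ b : M, ‖b‖ ≤ 1 ∧ f b = z} (orderInf {z | ∃ b : M, ‖b‖ ≤ 1 ∧ f b = z}) := by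
  have h : ∃ z, IsGLB {z | ∃ b : M, ‖b‖ ≤ 1 ∧ f b = z} z :=
    ⟨_, hN.isGLB_of_isLUB_neg (hN.isLUB_orderSup (f := fun b => -f b) (by simpa using hC))⟩
  rw [orderInf, dif_pos h]
  exact h.choose_spec

/-- The element `p t + (1 - p) s` still bounds every `f b`, hence dominates `s`. This carries
locality through quantifiers. -/
theorem character_isLUB_le_of_eqOn (hN : N.IsCentralIn M) {p : N} (hp : IsStarProjection p)
    {f g : M → selfAdjoint N}
    (hfg : ∀ b : M, ∀ χ : characterSpace ℂ N, χ p = 1 → χ (f b : N) = χ (g b : N))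
    {s t : selfAdjoint N} (hs : IsLUB {z | ∃ b : M, ‖b‖ ≤ 1 ∧ f b = z} s)
    (ht : IsLUB {z | ∃ b : M, ‖b‖ ≤ 1 ∧ g b = z} t) (χ : characterSpace ℂ N) (hχ : χ p = 1) :
    (χ (s : N)).re ≤ (χ (t : N)).re := by
  let w : selfAdjoint N := ⟨p * t + (1 - p) * s, by
    rw [selfAdjoint.mem_iff, star_add, star_mul, star_mul, star_sub, star_one,
      hp.isSelfAdjoint.star_eq, selfAdjoint.mem_iff.1 t.2, selfAdjoint.mem_iff.1 s.2]
    exact congrArg₂ _ (hN.commCStarAlgebra.mul_comm _ _) (hN.commCStarAlgebra.mul_comm _ _)⟩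
  have hw : ∀ ψ : characterSpace ℂ N,
      (ψ (w : N)).re = (ψ p * ψ (t : N) + (1 - ψ p) * ψ (s : N)).re := fun ψ => by
    simp only [w, map_add, map_mul, map_sub, map_one]
  have hsw : s ≤ w := hs.2 (by
    rintro _ ⟨b, hb, rfl⟩
    refine hN.le_iff_character.2 fun ψ => ?_
    rw [hw]
    rcases character_eq_zero_or_one hp ψ with h | h
    · simpa [h] using hN.le_iff_character.1 (hs.1 ⟨b, hb, rfl⟩) ψ
    · rw [hfg b ψ h]
      simpa [h] using hN.le_iff_character.1 (ht.1 ⟨b, hb, rfl⟩) ψ)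
  simpa [hw, hχ] using hN.le_iff_character.1 hsw χ

theorem character_isLUB_congr (hN : N.IsCentralIn M) {p : N} (hp : IsStarProjection p)
    {f g : M → selfAdjoint N}
    (hfg : ∀ b : M, ∀ χ : characterSpace ℂ N, χ p = 1 → χ (f b : N) = χ (g b : N))
    {s t : selfAdjoint N} (hs : IsLUB {z | ∃ b : M, ‖b‖ ≤ 1 ∧ f b = z} s)
    (ht : IsLUB {z | ∃ b : M, ‖b‖ ≤ 1 ∧ g b = z} t) (χ : characterSpace ℂ N) (hχ : χ p = 1) :
    χ (s : N) = χ (t : N) := by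
  rw [character_selfAdjoint χ s, character_selfAdjoint χ t, le_antisymm
    (hN.character_isLUB_le_of_eqOn hp hfg hs ht χ hχ)
    (hN.character_isLUB_le_of_eqOn hp (fun b ψ h => (hfg b ψ h).symm) ht hs χ hχ)]

theorem character_isGLB_congr (hN : N.IsCentralIn M) {p : N} (hp : IsStarProjection p)
    {f g : M → selfAdjoint N}
    (hfg : ∀ b : M, ∀ χ : characterSpace ℂ N, χ p = 1 → χ (f b : N) = χ (g b : N))
    {s t : selfAdjoint N} (hs : IsGLB {z | ∃ b : M, ‖b‖ ≤ 1 ∧ f b = z} s)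
    (ht : IsGLB {z | ∃ b : M, ‖b‖ ≤ 1 ∧ g b = z} t) (χ : characterSpace ℂ N) (hχ : χ p = 1) :
    χ (s : N) = χ (t : N) := by
  simpa using hN.character_isLUB_congr hp (f := fun b => -f b) (g := fun b => -g b)
    (fun b ψ h => by simpa using hfg b ψ h)
    (hN.isLUB_neg_of_isGLB hs) (hN.isLUB_neg_of_isGLB ht) χ hχ

end VonNeumannAlgebra.IsCentralIn

namespace TracialExpectation

open scoped ComplexOrder

variable (E : TracialExpectation hN)

theorem state_one (χ : characterSpace ℂ N) : E.state χ 1 = 1 := by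
  have : E.toLinearMap 1 = 1 := E.map_incl 1
  rw [state_apply, this, map_one]

theorem norm_state_le_of_isSelfAdjoint (χ : characterSpace ℂ N) {y : M} (hy : IsSelfAdjoint y) :
    ‖E.state χ y‖ ≤ ‖y‖ := by
  have hy' : IsSelfAdjoint (y : H →L[ℂ] H) := congrArg Subtype.val hy
  have key : ∀ z : M, IsSelfAdjoint (z : H →L[ℂ] H) → E.state χ z ≤ ((‖z‖ : ℝ) : ℂ) := by
    intro z hz
    have h : z ≤ ((‖z‖ : ℝ) : ℂ) • (1 : M) := by
      change (z : H →L[ℂ] H) ≤ ((‖z‖ : ℝ) : ℂ) • (1 : H →L[ℂ] H)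
      refine hz.le_algebraMap_norm_self.trans_eq ?_
      rw [Algebra.algebraMap_eq_smul_one, Complex.coe_smul]
      rfl
    have := E.state_mono χ h
    rwa [map_smul, state_one, smul_eq_mul, mul_one] at this
  have h1 := Complex.le_def.1 (key y hy')
  have h2 := Complex.le_def.1 (key (-y) hy'.neg)
  rw [map_neg, norm_neg] at h2
  have h3 : E.state χ y = ((E.state χ y).re : ℂ) := Complex.ext rfl (by simpa using h1.2)
  rw [h3, Complex.norm_real, Real.norm_eq_abs, abs_le]
  refine ⟨?_, h1.1⟩
  have := h2.1
  rw [Complex.neg_re, Complex.ofReal_re] at this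
  linarith

/-- The factor `2` comes from splitting into real and imaginary parts; any uniform constant suffices
for bounding formulas. -/
theorem norm_state_le (χ : characterSpace ℂ N) (y : M) : ‖E.state χ y‖ ≤ 2 * ‖y‖ := by
  have h := realPart_add_I_smul_imaginaryPart y
  have h1 := E.norm_state_le_of_isSelfAdjoint χ (ℜ y).2
  have h2 := E.norm_state_le_of_isSelfAdjoint χ (ℑ y).2
  have h3 : ‖(ℜ y : M)‖ ≤ ‖y‖ := realPart.norm_le y
  have h4 : ‖(ℑ y : M)‖ ≤ ‖y‖ := imaginaryPart.norm_le y
  calc ‖E.state χ y‖ = ‖E.state χ (ℜ y) + Complex.I * E.state χ (ℑ y)‖ := by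
        rw [← smul_eq_mul, ← map_smul, ← map_add, h]
    _ ≤ ‖E.state χ (ℜ y)‖ + ‖Complex.I * E.state χ (ℑ y)‖ := norm_add_le _ _
    _ = ‖E.state χ (ℜ y)‖ + ‖E.state χ (ℑ y)‖ := by simp
    _ ≤ 2 * ‖y‖ := by linarith

theorem character_apply_congr {p : N} {y z : M} (h : hN.incl p * y = hN.incl p * z)
    {χ : characterSpace ℂ N} (hχ : χ p = 1) :
    χ (E.toLinearMap y) = χ (E.toLinearMap z) := by
  have e : ∀ w : M, χ (E.toLinearMap w) = χ (E.toLinearMap (hN.incl p * w)) := fun w => by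
    have := E.map_bimodule p 1 w
    rw [mul_one, show hN.incl 1 = 1 from rfl, mul_one] at this
    rw [this, map_mul, hχ, one_mul]
  rw [e, h, ← e]

end TracialExpectation

namespace VonNeumannAlgebra

theorem character_realPart (χ : characterSpace ℂ N) (a : N) :
    χ (ℜ a : N) = ((χ a).re : ℂ) := by
  rw [realPart_apply_coe, ← Complex.coe_smul, map_smul, map_add, map_star]
  refine Complex.ext ?_ ?_ <;> simp; ring

theorem character_imaginaryPart (χ : characterSpace ℂ N) (a : N) :
    χ (ℑ a : N) = ((χ a).im : ℂ) := by
  have h := congrArg χ (realPart_add_I_smul_imaginaryPart a)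
  rw [map_add, map_smul, character_realPart, character_selfAdjoint χ (ℑ a)] at h
  have h1 := congrArg Complex.im h
  rw [character_selfAdjoint χ (ℑ a)]
  simpa using h1

end VonNeumannAlgebra

/-! ### Bounds and locality of the interpretation -/

theorem exists_norm_evalStarPolynomial_le {X : Type v} (M : VonNeumannAlgebra H)
    (p : FreeAlgebra ℂ (X ⊕ X)) (R : X → ℝ) :
    ∃ C, ∀ x : X → M, (∀ i, ‖x i‖ ≤ R i) → ‖evalStarPolynomial p x‖ ≤ C := by
  unfold evalStarPolynomial
  induction p using FreeAlgebra.induction with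
  | grade0 r =>
    exact ⟨‖algebraMap ℂ M r‖, fun x _ => by rw [AlgHom.commutes]⟩
  | grade1 i =>
    rcases i with i | i
    · exact ⟨R i, fun x hx => by simpa using hx i⟩
    · exact ⟨R i, fun x hx => by simpa using hx i⟩
  | mul a b ha hb =>
    obtain ⟨C, hC⟩ := ha
    obtain ⟨D, hD⟩ := hb
    refine ⟨C * D, fun x hx => ?_⟩
    rw [map_mul]
    exact (norm_mul_le _ _).trans (mul_le_mul (hC x hx) (hD x hx) (norm_nonneg _)
      ((norm_nonneg _).trans (hC x hx)))
  | add a b ha hb =>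
    obtain ⟨C, hC⟩ := ha
    obtain ⟨D, hD⟩ := hb
    refine ⟨C + D, fun x hx => ?_⟩
    rw [map_add]
    exact (norm_add_le _ _).trans (add_le_add (hC x hx) (hD x hx))

/-- Centrality lets `e` move past each factor of a product; self-adjointness handles the adjoint
variables. -/
theorem incl_mul_evalStarPolynomial_congr (hN : N.IsCentralIn M) {X : Type v} {e : N}
    (he : IsSelfAdjoint e) {x y : X → M} (hxy : ∀ i, hN.incl e * x i = hN.incl e * y i)
    (p : FreeAlgebra ℂ (X ⊕ X)) :
    hN.incl e * evalStarPolynomial p x = hN.incl e * evalStarPolynomial p y := by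
  unfold evalStarPolynomial
  induction p using FreeAlgebra.induction with
  | grade0 r => rw [AlgHom.commutes, AlgHom.commutes]
  | grade1 i =>
    rcases i with i | i
    · simpa using hxy i
    · have h := congrArg star (hxy i)
      have h' : star (hN.incl e) = hN.incl e := congrArg hN.incl he.star_eq
      rw [star_mul, star_mul, h', ← hN.incl_mul_comm, ← hN.incl_mul_comm] at h
      simpa using h
  | mul a b ha hb =>
    rw [map_mul, map_mul, ← mul_assoc, ha, hN.incl_mul_comm, mul_assoc, hb, ← mul_assoc,
      ← hN.incl_mul_comm, mul_assoc]
  | add a b ha hb => rw [map_add, map_add, mul_add, mul_add, ha, hb]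

namespace TracialFormula

open VonNeumannAlgebra

variable {X : Type v} [DecidableEq X] (E : TracialExpectation hN)

theorem norm_update_le {R : X → ℝ} {x : X → M} (hx : ∀ i, ‖x i‖ ≤ R i) (y : X) {b : M}
    (hb : ‖b‖ ≤ 1) (i : X) : ‖Function.update x y b i‖ ≤ Function.update R y 1 i := by
  by_cases h : i = y
  · subst h; simpa using hb
  · simpa [h] using hx i

/-- The radii `R` vary in the induction because a quantifier resets the radius of its variable to
`1`; a connective is bounded on a compact box. Boundedness ensures that `orderSup` and `orderInf`
never take their default value `0`. -/
theorem exists_bound_interpE (φ : TracialFormula X) (R : X → ℝ) :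
    ∃ C, ∀ x : X → M, (∀ i, ‖x i‖ ≤ R i) → ∀ χ : characterSpace ℂ N,
      |(χ (φ.interpE E x : N)).re| ≤ C := by
  induction φ generalizing R with
  | reTr p =>
    obtain ⟨C, hC⟩ := exists_norm_evalStarPolynomial_le M p R
    refine ⟨2 * C, fun x hx χ => ?_⟩
    rw [interpE, character_realPart, Complex.ofReal_re]
    exact (Complex.abs_re_le_norm _).trans ((E.norm_state_le χ _).trans
      (mul_le_mul_of_nonneg_left (hC x hx) zero_le_two))
  | imTr p =>
    obtain ⟨C, hC⟩ := exists_norm_evalStarPolynomial_le M p R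
    refine ⟨2 * C, fun x hx χ => ?_⟩
    rw [interpE, character_imaginaryPart, Complex.ofReal_re]
    exact (Complex.abs_im_le_norm _).trans ((E.norm_state_le χ _).trans
      (mul_le_mul_of_nonneg_left (hC x hx) zero_le_two))
  | connective f φ ih =>
    choose C hC using fun i => ih i R
    obtain ⟨D, hD⟩ := (isCompact_univ_pi fun i =>
      isCompact_Icc (a := -C i) (b := C i)).exists_bound_of_continuousOn
      f.continuous.continuousOn
    refine ⟨D, fun x hx χ => ?_⟩
    rw [interpE, hN.character_functionalCalculus, Complex.ofReal_re]
    exact hD _ fun i _ => abs_le.1 (hC i x hx χ)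
  | sup y φ ih =>
    obtain ⟨C, hC⟩ := ih (Function.update R y 1)
    refine ⟨C, fun x hx => ?_⟩
    have h : ∀ b : M, ‖b‖ ≤ 1 → ∀ χ : characterSpace ℂ N,
        |(χ (φ.interpE E (Function.update x y b) : N)).re| ≤ C := fun b hb =>
      hC _ (norm_update_le hx y hb)
    exact hN.abs_character_isLUB_le h (hN.isLUB_orderSup h)
  | inf y φ ih =>
    obtain ⟨C, hC⟩ := ih (Function.update R y 1)
    refine ⟨C, fun x hx => ?_⟩
    have h : ∀ b : M, ‖b‖ ≤ 1 → ∀ χ : characterSpace ℂ N,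
        |(χ (φ.interpE E (Function.update x y b) : N)).re| ≤ C := fun b hb =>
      hC _ (norm_update_le hx y hb)
    exact hN.abs_character_isGLB_le h (hN.isGLB_orderInf h)

theorem exists_bound_interpE_update (φ : TracialFormula X) (x : X → M) (y : X) :
    ∃ C, ∀ b : M, ‖b‖ ≤ 1 → ∀ χ : characterSpace ℂ N,
      |(χ (φ.interpE E (Function.update x y b) : N)).re| ≤ C := by
  obtain ⟨C, hC⟩ := φ.exists_bound_interpE E (Function.update (fun i => ‖x i‖) y 1)
  exact ⟨C, fun b hb => hC _ (norm_update_le (fun i => le_rfl) y hb)⟩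

theorem isLUB_interpE_sup (φ : TracialFormula X) (x : X → M) (y : X) :
    IsLUB {z | ∃ b : M, ‖b‖ ≤ 1 ∧ φ.interpE E (Function.update x y b) = z}
      ((sup y φ).interpE E x) :=
  hN.isLUB_orderSup (φ.exists_bound_interpE_update E x y).choose_spec

theorem isGLB_interpE_inf (φ : TracialFormula X) (x : X → M) (y : X) :
    IsGLB {z | ∃ b : M, ‖b‖ ≤ 1 ∧ φ.interpE E (Function.update x y b) = z}
      ((inf y φ).interpE E x) :=
  hN.isGLB_orderInf (φ.exists_bound_interpE_update E x y).choose_spec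

theorem mul_update_congr {e : M} {x x' : X → M} (h : ∀ i, e * x i = e * x' i) (y : X) {b b' : M}
    (hb : e * b = e * b') (i : X) :
    e * Function.update x y b i = e * Function.update x' y b' i := by
  by_cases hi : i = y
  · subst hi; simpa using hb
  · simpa [hi] using h i

/-- Locality of formulas in all variables jointly, the form that survives induction: bound variables
receive equal values on both sides. -/
theorem character_interpE_congr (φ : TracialFormula X) {e : N} (he : IsStarProjection e)
    {x x' : X → M} (h : ∀ i, hN.incl e * x i = hN.incl e * x' i) (χ : characterSpace ℂ N)
    (hχ : χ e = 1) : χ (φ.interpE E x : N) = χ (φ.interpE E x' : N) := by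
  induction φ generalizing x x' χ with
  | reTr p =>
    simp only [interpE, character_realPart]
    rw [E.character_apply_congr
      (incl_mul_evalStarPolynomial_congr hN he.isSelfAdjoint h p) hχ]
  | imTr p =>
    simp only [interpE, character_imaginaryPart]
    rw [E.character_apply_congr
      (incl_mul_evalStarPolynomial_congr hN he.isSelfAdjoint h p) hχ]
  | connective f φ ih =>
    simp only [interpE, hN.character_functionalCalculus, fun i => ih i h χ hχ]
  | sup y φ ih =>
    exact hN.character_isLUB_congr he (fun b ψ hψ => ih (mul_update_congr h y rfl) ψ hψ)
      (isLUB_interpE_sup E φ x y) (isLUB_interpE_sup E φ x' y) χ hχ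
  | inf y φ ih =>
    exact hN.character_isGLB_congr he (fun b ψ hψ => ih (mul_update_congr h y rfl) ψ hψ)
      (isGLB_interpE_inf E φ x y) (isGLB_interpE_inf E φ x' y) χ hχ

theorem isLocal_interpE_update (φ : TracialFormula X) (x : X → M) (y : X) :
    hN.IsLocal fun b => φ.interpE E (Function.update x y b) :=
  fun _ he _ _ h χ hχ => φ.character_interpE_congr E he (mul_update_congr (fun _ => rfl) y h) χ hχ

end TracialFormula

end

/-! ### Lifting the unit ball of the ultrafiber -/

section

open WeakDual

variable {H : Type u} [NormedAddCommGroup H] [InnerProductSpace ℂ H] [CompleteSpace H]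
  {N M : VonNeumannAlgebra H} {hN : N.IsCentralIn M}

namespace TracialExpectation

open scoped ComplexOrder

variable (E : TracialExpectation hN) (U : characterSpace ℂ N)

theorem state_star_mul_mul_le (m r : M) :
    E.state U (star (m * r) * (m * r)) ≤ ((‖m‖ ^ 2 : ℝ) : ℂ) * E.state U (star r * r) := by
  have h1 : star (m * r) * (m * r) ≤ ((‖m‖ ^ 2 : ℝ) : ℂ) • (star r * r) := by
    have h := star_left_conjugate_le_conjugate
      (CStarAlgebra.star_mul_le_algebraMap_norm_sq (a := (m : H →L[ℂ] H))) (r : H →L[ℂ] H)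
    change star ((m : H →L[ℂ] H) * r) * ((m : H →L[ℂ] H) * r) ≤
      ((‖(m : H →L[ℂ] H)‖ ^ 2 : ℝ) : ℂ) • (star (r : H →L[ℂ] H) * r)
    convert h using 1
    · simp [mul_assoc]
    · rw [Algebra.algebraMap_eq_smul_one]
      simp only [mul_smul_comm, smul_mul_assoc, mul_one]
      rw [Complex.coe_smul]
  simpa only [map_smul, smul_eq_mul] using E.state_mono U h1

namespace Ultrafiber

theorem norm_mk_le (m : M) : ‖mk E U m‖ ≤ ‖m‖ :=
  Submodule.Quotient.norm_mk_le (E.ultraIdeal U) m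

theorem exists_norm_lt (a : E.Ultrafiber U) {ε : ℝ} (hε : 0 < ε) :
    ∃ m, mk E U m = a ∧ ‖m‖ < ‖a‖ + ε :=
  Submodule.Quotient.norm_mk_lt (S := E.ultraIdeal U) a hε

theorem state_congr {m m' : M} (h : mk E U m = mk E U m') :
    E.state U (star m * m) = E.state U (star m' * m') := by
  rw [state_apply, state_apply, ← trace_mk, ← trace_mk, map_mul (mk E U),
    map_mul (mk E U), mk_star, mk_star, h]

theorem mk_eq_zero_iff {m : M} : mk E U m = 0 ↔ E.state U (star m * m) = 0 := by
  rw [← map_zero (mk E U), mk_eq_mk_iff, sub_zero]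
  rfl

/-- The inequality `r* x* x r ≤ r* r` holds under the trace if `x` has norm at most one in the
ultrafiber. -/
theorem state_star_mul_mul_le_of_norm_mk_le_one (x r : M) (hx : ‖mk E U x‖ ≤ 1) :
    E.state U (star (x * r) * (x * r)) ≤ E.state U (star r * r) := by
  have hr := E.state_nonneg U (star_mul_self_nonneg_coe r)
  have key : ∀ ε : ℝ, 0 < ε → E.state U (star (x * r) * (x * r)) ≤
      (((1 + ε) ^ 2 : ℝ) : ℂ) * E.state U (star r * r) := by
    intro ε hε
    -- The values depend only on classes in the ultrafiber, so `x` may be replaced by a lift of norm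
    -- below `1 + ε`; then `ε` tends to `0`.
    obtain ⟨m, hm, hmε⟩ := exists_norm_lt E U (mk E U x) hε
    have h1 : mk E U (x * r) = mk E U (m * r) := by rw [map_mul, map_mul, hm]
    rw [state_congr E U h1]
    refine (E.state_star_mul_mul_le U m r).trans (mul_le_mul_of_nonneg_right ?_ hr)
    rw [Complex.real_le_real]
    have := norm_nonneg m
    gcongr
    linarith
  have hx0 := Complex.nonneg_iff.1 (E.state_nonneg U (star_mul_self_nonneg_coe (x * r)))
  have hr0 := Complex.nonneg_iff.1 hr
  refine Complex.le_def.2 ⟨?_, hx0.2.symm.trans hr0.2⟩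
  have hlim : Filter.Tendsto (fun ε : ℝ => (1 + ε) ^ 2 * (E.state U (star r * r)).re)
      (nhdsWithin 0 (Set.Ioi 0)) (nhds ((1 + 0) ^ 2 * (E.state U (star r * r)).re)) :=
    (Continuous.tendsto (by fun_prop) 0).mono_left nhdsWithin_le_nhds
  rw [add_zero, one_pow, one_mul] at hlim
  refine ge_of_tendsto hlim (eventually_mem_nhdsWithin.mono fun ε hε => ?_)
  have := (Complex.le_def.1 (key ε hε)).1
  rwa [Complex.re_ofReal_mul] at this

theorem state_cfc_mono {a : M} {f g : ℝ → ℝ} (hf : Continuous f) 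
    (hg : Continuous g) (h : ∀ t, f t ≤ g t) :
    E.state U (cfc f a) ≤ E.state U (cfc g a) := by
  have hs : cfc g a - cfc f a =
      star (cfc (fun t => √(g t - f t)) a) * cfc (fun t => √(g t - f t)) a := by
    rw [(cfc_predicate (fun t => √(g t - f t)) a).star_eq,
      ← cfc_mul _ _ a (by fun_prop) (by fun_prop), ← cfc_sub _ _ a (by fun_prop) (by fun_prop)]
    congr 1
    funext t
    exact (Real.mul_self_sqrt (sub_nonneg.2 (h t))).symm
  rw [← sub_nonneg, ← map_sub, hs]
  exact E.state_nonneg U (star_mul_self_nonneg_coe _)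

/-- The unit ball of `M` maps onto the unit ball of the ultrafiber. -/
theorem exists_norm_le_one {a : E.Ultrafiber U} (ha : ‖a‖ ≤ 1) :
    ∃ b : M, ‖b‖ ≤ 1 ∧ mk E U b = a := by
  obtain ⟨x, rfl⟩ := mk_surjective E U a
  let c : M := star x * x
  have hc : IsSelfAdjoint c := IsSelfAdjoint.star_mul_self x
  have hspec : ∀ t ∈ spectrum ℝ c, 0 ≤ t := spectrum_star_mul_self_nonneg
  let g : ℝ → ℝ := fun t => (√(max t 1))⁻¹
  let h : ℝ → ℝ := fun t => max t 1 - 1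
  let r : ℝ → ℝ := fun t => √(h t)
  have hh0 : ∀ t, 0 ≤ h t := fun t => sub_nonneg.2 (le_max_right _ _)
  have hs1 : ∀ t : ℝ, 1 ≤ √(max t 1) := fun t => Real.one_le_sqrt.2 (le_max_right _ _)
  have hg : Continuous g := by
    refine Continuous.inv₀ (by fun_prop) fun t => ?_
    exact (zero_lt_one.trans_le (hs1 t)).ne'
  have hh : Continuous h := by fun_prop
  have hr : Continuous r := by fun_prop
  have hstar : ∀ f : ℝ → ℝ, star (cfc f c) = cfc f c := fun f => (cfc_predicate f c).star_eq
  have hid : c = cfc (fun t : ℝ => t) c := (cfc_id' ℝ c).symm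
  have hprod : ∀ f : ℝ → ℝ, Continuous f →
      star (x * cfc f c) * (x * cfc f c) = cfc (fun t => f t * t * f t) c := by
    intro f hf
    rw [cfc_mul _ _ c (by fun_prop) (by fun_prop), cfc_mul _ _ c (by fun_prop) (by fun_prop),
      ← hid, star_mul, hstar]
    simp only [c, mul_assoc]
  have hsq : ∀ f : ℝ → ℝ, Continuous f →
      star (cfc f c) * cfc f c = cfc (fun t => f t * f t) c := by
    intro f hf
    rw [cfc_mul _ _ c (by fun_prop) (by fun_prop), hstar]
  refine ⟨x * cfc g c, ?_, ?_⟩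
  · have h1 : ‖star (x * cfc g c) * (x * cfc g c)‖ ≤ 1 := by
      rw [hprod g hg]
      refine norm_cfc_le zero_le_one fun t ht => ?_
      have ht0 := hspec t ht
      have h2 : g t * t * g t = t / max t 1 := by
        have := Real.mul_self_sqrt (zero_le_one.trans (le_max_right t 1))
        simp only [g]
        conv_rhs => rw [← this]
        field_simp
      rw [h2, Real.norm_of_nonneg (by positivity)]
      exact div_le_one_of_le₀ (le_max_left _ _) (by positivity)
    rw [CStarRing.norm_star_mul_self] at h1
    nlinarith [norm_nonneg (x * cfc g c)]
  -- Tested at `r(c)` with `r² = h = max(t,1) - 1`, the inequality compares the states of `t h` and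
  -- `h`. Since `t h = h + h²`, the state of `h(c)²` is at most `0`.
  · have h1 := state_star_mul_mul_le_of_norm_mk_le_one E U x (cfc r c) ha
    rw [hprod r hr, hsq r hr] at h1
    have h2 : (fun t => r t * t * r t) = fun t => r t * r t + h t * h t := by
      funext t
      have hrr : r t * r t = h t := Real.mul_self_sqrt (hh0 t)
      rw [mul_right_comm, hrr]
      simp only [h]
      rcases le_total t 1 with ht | ht <;> simp [ht]
      ring
    rw [h2, cfc_add _ _ _ (by fun_prop) (by fun_prop), map_add, add_le_iff_nonpos_right] at h1
    let k : ℝ → ℝ := fun t => 1 - g t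
    have hk : Continuous k := by fun_prop
    have h3 : E.state U (star (cfc k c) * cfc k c) = 0 := by
      refine le_antisymm ?_ (E.state_nonneg U (star_mul_self_nonneg_coe _))
      rw [hsq k hk]
      refine (state_cfc_mono E U (by fun_prop) (by fun_prop) fun t => ?_).trans h1
      have hk0 : 0 ≤ k t := sub_nonneg.2 (inv_le_one_of_one_le₀ (hs1 t))
      -- With `s = √max(t,1) ≥ 1` this reads `1 - 1/s ≤ s² - 1`. It gives `k² ≤ h²`, so `k(c)` lies
      -- in the ideal.
      have hkh : k t ≤ h t := by
        simp only [k, g, h]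
        have h4 := hs1 t
        have h5 : √(max t 1) ≤ max t 1 := 
          Real.sqrt_le_left (by positivity) |>.2 (by nlinarith [le_max_right t 1])
        have h6 : (√(max t 1))⁻¹ * √(max t 1) = 1 := inv_mul_cancel₀ (by positivity)
        have h7 : 0 < (√(max t 1))⁻¹ := by positivity
        nlinarith [sq_nonneg (√(max t 1) - 1)]
      exact mul_le_mul hkh hkh hk0 (hh0 t)
    have h4 : mk E U (cfc k c) = 0 := (mk_eq_zero_iff E U).2 h3
    have h5 : cfc k c = 1 - cfc g c := by
      rw [cfc_sub _ _ _ (by fun_prop) (by fun_prop), cfc_const_one ℝ c]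
    rw [h5, map_sub, map_one, sub_eq_zero] at h4
    rw [map_mul, ← h4, mul_one]

end Ultrafiber

end TracialExpectation

end

/-! ### The induction on formulas -/

namespace TracialExpectation.Ultrafiber

variable {H : Type u} [NormedAddCommGroup H] [InnerProductSpace ℂ H] [CompleteSpace H]
  {N M : VonNeumannAlgebra H} {hN : N.IsCentralIn M}
  (E : TracialExpectation hN) (U : WeakDual.characterSpace ℂ N) {X : Type v}

theorem evalStarPolynomial_mk (p : FreeAlgebra ℂ (X ⊕ X)) (x : X → M) :
    evalStarPolynomial p (fun i => mk E U (x i)) = mk E U (evalStarPolynomial p x) := by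
  unfold evalStarPolynomial
  rw [← AlgHom.comp_apply]
  congr 1
  ext (i | i) <;> simp [mk_star]

theorem mk_update [DecidableEq X] (x : X → M) (y : X) (b : M) :
    Function.update (fun i => mk E U (x i)) y (mk E U b) =
      fun i => mk E U (Function.update x y b i) :=
  (Function.comp_update (mk E U) x y b).symm

/-- The unit balls of `M` and of the ultrafiber give the same values. -/
theorem setOf_ball_eq {f : E.Ultrafiber U → ℝ} {g : M → ℝ} (h : ∀ b, f (mk E U b) = g b) :
    {r | ∃ a : E.Ultrafiber U, ‖a‖ ≤ 1 ∧ f a = r} = {r | ∃ b : M, ‖b‖ ≤ 1 ∧ g b = r} := by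
  ext r
  constructor
  · rintro ⟨a, ha, rfl⟩
    obtain ⟨b, hb, rfl⟩ := exists_norm_le_one E U ha
    exact ⟨b, hb, (h b).symm⟩
  · rintro ⟨b, hb, rfl⟩
    exact ⟨mk E U b, (norm_mk_le E U b).trans hb, h b⟩

theorem interp_mk [DecidableEq X] (φ : TracialFormula X) (x : X → M) :
    φ.interp (trace E U) (fun i => mk E U (x i)) = (U (φ.interpE E x : N)).re := by
  induction φ generalizing x with
  | reTr p =>
    rw [TracialFormula.interp, TracialFormula.interpE, evalStarPolynomial_mk, trace_mk,
      VonNeumannAlgebra.character_realPart, Complex.ofReal_re]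
  | imTr p =>
    rw [TracialFormula.interp, TracialFormula.interpE, evalStarPolynomial_mk, trace_mk,
      VonNeumannAlgebra.character_imaginaryPart, Complex.ofReal_re]
  | connective f φ ih =>
    rw [TracialFormula.interp, TracialFormula.interpE, hN.character_functionalCalculus,
      Complex.ofReal_re]
    simp only [ih]
  | sup y φ ih =>
    rw [TracialFormula.interp, setOf_ball_eq E U (g := fun b =>
      (U (φ.interpE E (Function.update x y b) : N)).re) fun b => by rw [mk_update, ih]]
    exact ((φ.isLocal_interpE_update E x y).isLUB_character
      (φ.isLUB_interpE_sup E x y) U).csSup_eq ⟨_, 0, by simp, rfl⟩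
  | inf y φ ih =>
    rw [TracialFormula.interp, setOf_ball_eq E U (g := fun b =>
      (U (φ.interpE E (Function.update x y b) : N)).re) fun b => by rw [mk_update, ih]]
    exact ((φ.isLocal_interpE_update E x y).isGLB_character
      (φ.isGLB_interpE_inf E x y) U).csInf_eq ⟨_, 0, by simp, rfl⟩

end TracialExpectation.Ultrafiber

theorem mainTheorem3 {H : Type*} [NormedAddCommGroup H] [InnerProductSpace ℂ H] [CompleteSpace H]
    (M N : VonNeumannAlgebra H) (hM : M.IsFinite) (hN : N.IsCentralIn M)
    (E : TracialExpectation hN) (U : WeakDual.characterSpace ℂ N)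
    {X : Type*} [DecidableEq X] (φ : TracialFormula X) (x : X → M) :
    ((φ.interp (TracialExpectation.Ultrafiber.trace E U)
        (fun i => TracialExpectation.Ultrafiber.mk E U (x i)) : ℝ) : ℂ) =
      U (φ.interpE E x : N) := by
  rw [TracialExpectation.Ultrafiber.interp_mk, ← VonNeumannAlgebra.character_selfAdjoint]
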